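/- **Setting.** Let $\Omega$ be a set of $n$ arms, $1\le k\le n$, and let $1\le m\le m'$ be integers ($m'$ agents, of which $m$ communicate in each round). Let $f:2^\Omega\to\mathbb R$ be monotone ($f(A)\le f(B)$ for $A\subseteq B$) and submodular ($f(A\cup\{v\})-f(A)\ge f(B\cup\{v\})-f(B)$ for $A\subseteq B$, $v\notin B$). At each time $t=1,\dots,T$ every agent $i$ plays a set $S_{i,t}$ with $|S_{i,t}|\le k$ and observes only a reward $f_{i,t}(S_{i,t})$; the random functions $f_{i,t}$ are independent over $i$ and $t$, with values in $[0,1]$ and mean $\mathbb E f_{i,t}(S)=f(S)$ for all $|S|\le k$. Let $S^\star$ maximize $f$ over sets of size at most $k$. The $\alpha$-regret of agent $i$ is $\mathcal R_i(T)=\sum_{t=1}^T\big(\alpha f_{i,t}(S^\star)-f_{i,t}(S_{i,t})\big)$. **Stochastic-Greedy$(\epsilon)$.** Start with $A=\emptyset$. Repeat $k$ times: draw uniformly at random a set $R$ of $s=\lceil\frac nk\log\frac1\epsilon\rceil$ elements of $\Omega\setminus A$ (all of $\Omega\setminus A$ if it has fewer than $s$ elements; $s=0$ and $A$ is left unchanged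 if $\epsilon\ge 1$), query the value of $A\cup\{a\}$ for each $a\in R$, and add to $A$ an element $a$ with the largest answer. Output $A$. **C-MA-MAB with Stochastic-Greedy.** Put $$r=\Big\lceil \tfrac1m\big(2k\sqrt{\log T}\,\tfrac{Tm}{n}\big)^{2/3}\Big\rceil,\qquad \epsilon^\star=\frac{n r}{T}.$$ Run Stochastic-Greedy$(\epsilon^\star)$. Whenever it queries a set $A$ (one communication round), each of the $m'$ agents plays $A$ for $r$ time steps, $m$ uniformly random agents report their empirical means, and the average of these $m$ means is the answer to the query. Once the algorithm outputs $\Theta$, all agents play $\Theta$ for the remaining time. All random choices are independent of each other and of the reward functions. **Theorem.** (a) There are universal constants $C>0$ and $p\ge 0$ such that, for all $n,k,m,m'$ as above, all $T\ge 2$ with $T\ge nm$, and all such environments, C-MA-MAB with Stochastic-Greedy as subroutine uses almost surely at most $C\,n\,(\log T)^p$ communication rounds, and for each agent $i$ the $(1-1/e)$-regret is integrable with $$\mathbb E[\mathcal R_i(T)]\le C\, m^{-1/3}k^{2/3}n^{1/3}T^{2/3}(\log T)^p .$$ For fixed $n,k,m$ this bound is $o(T)$ as $T\to\infty$. (b)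 Offline, with an exact value oracle for a nonnegative monotone submodular $f$ and $0<\epsilon<1$, the output $\Theta$ of Stochastic-Greedy$(\epsilon)$ satisfies $\mathbb E[f(\Theta)]\ge(1-1/e-\epsilon)\,f(S^\star)$. -/

import Mathlib

open MeasureTheory ProbabilityTheory Finset

/-- A deterministic interactive algorithm with access to a value oracle for sets of arms: it either
stops and outputs a set, or queries the value of a set and continues according to the answer.
A randomized algorithm is a family of these, indexed by its random choices. -/
inductive QueryAlgorithm (V : Type) : Type
  | output (Θ : Finset V) : QueryAlgorithm V
  | query (A : Finset V) (next : ℝ → QueryAlgorithm V) : QueryAlgorithm V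

/-- Running an algorithm when the answer to the `j`-th query, if it asks for `A`, is `oracle j A`
(the first query has number `j`). The result is the list of the queried sets, in order, and the
output. -/
def QueryAlgorithm.run {V : Type} (oracle : ℕ → Finset V → ℝ) :
    QueryAlgorithm V → ℕ → List (Finset V) × Finset V
  | .output Θ, _ => ([], Θ)
  | .query A next, j =>
      (A :: (run oracle (next (oracle j A)) (j + 1)).1, (run oracle (next (oracle j A)) (j + 1)).2)

/-- Diminishing returns. -/
def IsSubmodularFn {V : Type} [DecidableEq V] (f : Finset V → ℝ) : Prop :=
  ∀ A B : Finset V, A ⊆ B → ∀ v, v ∉ B → f (insert v B) - f B ≤ f (insert v A) - f A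

/-- `S` is a maximizer of `f` among the sets with at most `k` elements. -/
def IsOptimalSet {V : Type} (k : ℕ) (f : Finset V → ℝ) (S : Finset V) : Prop :=
  S.card ≤ k ∧ ∀ B : Finset V, B.card ≤ k → f B ≤ f S

/-! ### Stochastic-Greedy -/

/-- Query `A ∪ {a}` for every `a` in the list and pass on the element with the largest answer
(the first one in case of ties; `none` if there was no candidate). The second argument is the best
candidate so far together with its value. As `f A` does not depend on `a`, maximizing the value of
`A ∪ {a}` is maximizing the marginal gain of `a`. -/
noncomputable def queryBest {V : Type} [DecidableEq V] (A : Finset V)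
    (next : Option V → QueryAlgorithm V) : List V → Option (V × ℝ) → QueryAlgorithm V
  | [], best => next (best.map Prod.fst)
  | a :: l, best => .query (insert a A) fun y => queryBest A next l
      (match best with
        | none => some (a, y)
        | some (b, z) => if z < y then some (a, y) else some (b, z))

/-- The iterations `l, l + 1, …` of Stochastic-Greedy (`d` iterations in all) from the current set
`A`, where `R l A` is the random sample of candidates drawn in iteration `l` if the current set
is `A`. -/
noncomputable def stochasticGreedyFrom {V : Type} [DecidableEq V]
    (R : ℕ → Finset V → Finset V) : (d l : ℕ) → (A : Finset V) → QueryAlgorithm V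
  | 0, _, A => .output A
  | d + 1, l, A => queryBest A
      (fun best => match best with
        | none => stochasticGreedyFrom R d (l + 1) A
        | some a => stochasticGreedyFrom R d (l + 1) (insert a A))
      (R l A).toList none

/-- Stochastic-Greedy with cardinality constraint `k`: `k` iterations from the empty set. -/
noncomputable def stochasticGreedy {V : Type} [DecidableEq V] (k : ℕ)
    (R : ℕ → Finset V → Finset V) : QueryAlgorithm V :=
  stochasticGreedyFrom R k 0 ∅

/-- The sample size `⌈(n / k) log (1 / ε)⌉` of Stochastic-Greedy. -/
noncomputable def sampleSize (n k : ℕ) (ε : ℝ) : ℕ :=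
  ⌈(n : ℝ) / k * Real.log (1 / ε)⌉₊

/-- The random set `Y` is measurable and uniformly distributed on the nonempty family `F`. -/
def IsUniformSet {Ω' : Type*} [MeasurableSpace Ω'] {V : Type} (μ : Measure Ω')
    (Y : Ω' → Finset V) (F : Finset (Finset V)) : Prop :=
  (∀ B, MeasurableSet (Y ⁻¹' {B})) ∧ F.Nonempty ∧ ∀ B ∈ F, μ (Y ⁻¹' {B}) = (F.card : ENNReal)⁻¹

/-- The samples of Stochastic-Greedy: in each iteration `l`, if the current set is `A`, the sample
is a uniformly random set of `s` elements outside `A` (of all of them, if there are fewer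
than `s`). -/
def IsGreedySampling {Ω' : Type*} [MeasurableSpace Ω'] {V : Type} [Fintype V] [DecidableEq V]
    (μ : Measure Ω') (s : ℕ) (R : ℕ → Finset V → Ω' → Finset V) : Prop :=
  ∀ l A, IsUniformSet μ (R l A) (Finset.powersetCard (min s (Aᶜ).card) Aᶜ)

/-- The σ-algebra of the random choices of iteration `l` of Stochastic-Greedy. -/
@[reducible] def greedySigma {Ω' : Type*} {V : Type} (R : ℕ → Finset V → Ω' → Finset V) (l : ℕ) :
    MeasurableSpace Ω' :=
  MeasurableSpace.comap (fun ω A => R l A ω) (⊤ : MeasurableSpace (Finset V → Finset V))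

/-! ### C-MA-MAB

Time steps and communication rounds are numbered from `0`. -/

/-- The number `r_i⋆` of times each agent plays each queried action. -/
noncomputable def cmamabReps (β ψ δ : ℝ) (m T : ℕ) : ℕ :=
  ⌈(m : ℝ)⁻¹ * (δ * √(Real.log T) * ((T : ℝ) * m / ψ) ^ (1 / (β + 1))) ^
    ((2 + 2 * β) / (3 + β))⌉₊

open Classical in
/-- The accuracy `ε⋆` with which the offline algorithm is run. -/
noncomputable def cmamabEps (β γ ψ δ : ℝ) (m T : ℕ) : ℝ :=
  if 0 < β ∨ 0 < γ then (ψ * cmamabReps β ψ δ m T / T) ^ (1 / (β + 1)) else 0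

/-- The value that the server feeds to the offline algorithm in round `j`, if the action is `A`:
the mean over the `m` selected agents `Q j` of their local means over the `r` plays of that
round; `X i t A` is the reward of agent `i` at time `t` for playing `A`. -/
noncomputable def cmamabFeedback {V Agent : Type} (m r : ℕ) (X : Agent → ℕ → Finset V → ℝ)
    (Q : ℕ → Finset Agent) (j : ℕ) (A : Finset V) : ℝ :=
  (∑ i ∈ Q j, (∑ u ∈ Finset.range r, X i (j * r + u) A) / r) / m

/-- The exploration phase of C-MA-MAB with a given offline algorithm: the queried actions, one for
each communication round, and the final output. -/
noncomputable def cmamabRun {V Agent : Type} (m r : ℕ) (X : Agent → ℕ → Finset V → ℝ)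
    (Q : ℕ → Finset Agent) (alg : QueryAlgorithm V) : List (Finset V) × Finset V :=
  alg.run (cmamabFeedback m r X Q) 0

/-- The action that every agent plays at time `t`: the `j`-th queried action during the time steps
`j * r, …, j * r + r - 1`, and the output of the offline algorithm once the queries are over. -/
def cmamabAction {V : Type} (r : ℕ) (run : List (Finset V) × Finset V) (t : ℕ) : Finset V :=
  run.1.getD (t / r) run.2

/-- The cumulative `α`-regret of agent `i` over the time steps `0, …, T - 1`, for the actions
`act t` and the comparison set `Sstar`. -/
noncomputable def alphaRegret {V Agent : Type} (α : ℝ) (T : ℕ) (X : Agent → ℕ → Finset V → ℝ)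
    (Sstar : Finset V) (act : ℕ → Finset V) (i : Agent) : ℝ :=
  ∑ t ∈ Finset.range T, (α * X i t Sstar - X i t (act t))

/-- The stochastic environment of C-MA-MAB with Stochastic-Greedy as subroutine:
rewards in `[0, 1]` with mean `f` for the sets of at most `k` arms, uniformly random sets `Q j` of
`m` communicating agents, and the samples `R` of Stochastic-Greedy with sample size `s`; the reward
functions of the different agents and times and all random choices are independent. -/
structure IsGreedyBanditEnv {Ω' : Type*} [MeasurableSpace Ω'] {V Agent : Type} [Fintype V]
    [DecidableEq V] [Fintype Agent] (μ : Measure Ω') (k m s : ℕ) (f : Finset V → ℝ)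
    (X : Agent → ℕ → Finset V → Ω' → ℝ) (Q : ℕ → Ω' → Finset Agent)
    (R : ℕ → Finset V → Ω' → Finset V) : Prop where
  measurable_reward : ∀ i t A, Measurable (X i t A)
  reward_mem : ∀ i t A, A.card ≤ k → ∀ᵐ ω ∂μ, X i t A ω ∈ Set.Icc (0 : ℝ) 1
  reward_mean : ∀ i t A, A.card ≤ k → ∫ ω, X i t A ω ∂μ = f A
  agents_uniform : ∀ j, IsUniformSet μ (Q j) (Finset.powersetCard m Finset.univ)
  sampling : IsGreedySampling μ s R
  indep : iIndep (fun c : (Agent × ℕ) ⊕ ℕ ⊕ ℕ => match c with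
    | .inl p => MeasurableSpace.comap (fun ω A => X p.1 p.2 A ω) MeasurableSpace.pi
    | .inr (.inl j) => MeasurableSpace.comap (Q j) ⊤
    | .inr (.inr l) => greedySigma R l) μ

/-- The exploration phase of C-MA-MAB with Stochastic-Greedy `(1 - 1/e, 0, 1, n, 2k)` as
subroutine, at the outcome `ω`. -/
noncomputable def cmamabGreedyRun {Ω' : Type*} {n m' : ℕ} (k m T : ℕ)
    (X : Fin m' → ℕ → Finset (Fin n) → Ω' → ℝ) (Q : ℕ → Ω' → Finset (Fin m'))
    (R : ℕ → Finset (Fin n) → Ω' → Finset (Fin n)) (ω : Ω') :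
    List (Finset (Fin n)) × Finset (Fin n) :=
  cmamabRun m (cmamabReps 0 n (2 * k) m T) (fun i t A => X i t A ω) (fun j => Q j ω)
    (stochasticGreedy k fun l A => R l A ω)

/-- The `(1 - 1/e)`-regret of agent `i` under C-MA-MAB with Stochastic-Greedy. -/
noncomputable def cmamabGreedyRegret {Ω' : Type*} {n m' : ℕ} (k m T : ℕ)
    (X : Fin m' → ℕ → Finset (Fin n) → Ω' → ℝ) (Q : ℕ → Ω' → Finset (Fin m'))
    (R : ℕ → Finset (Fin n) → Ω' → Finset (Fin n)) (Sstar : Finset (Fin n)) (i : Fin m')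
    (ω : Ω') : ℝ :=
  alphaRegret (1 - 1 / Real.exp 1) T (fun i t A => X i t A ω) Sstar
    (cmamabAction (cmamabReps 0 n (2 * k) m T) (cmamabGreedyRun k m T X Q R ω)) i

/-! The algorithm explores and then commits, so the regret splits into the exploration time and `T`
times the expected deficit of the final set. That deficit is controlled by a version of the greedy
argument that tolerates noisy answers.

Offline part. Fix the current set `A` and put `U = S \ A`, `u = |U|`. A uniform sample of `s` of the
`N` remaining elements misses `U` with probability at most `(1 - s/N)^u`. By the choice of `s` this
is at most `ε^(u/k)`, and by convexity at most `1 - (1 - ε)u/k`. Given that the sample meets `U`, a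
random element of the intersection is, by symmetry, uniform on `U`. Hence the best sampled element
gains on average at least `(1 - ε)/k * (f S - f A)` (`sum_bestValue_ge`). If an iteration loses `η`
against that best element, the expected deficit satisfies `d (l + 1) ≤ (1 - c) * d l + E η` with `c
= (1 - ε)/k`. Since `(1 - c)^k ≤ exp (-(1 - ε)) ≤ 1/e + ε`, the output is as good as claimed up to
`k * E η` (`integral_greedy_ge`).

Noise. If every answer is within `δ` of its mean, choosing the largest answer costs at most `2δ`
(`greedyState_succ_ge`). The set queried in round `j` depends only on the random choices and on
rewards before that round, so it is independent of the rewards that evaluate it. Conditionally on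
it, Hoeffding applies to a mean of `m * r` rewards. With `δ = √(log T / (m r))` a round fails with
probability at most `2 / T^2`. A union bound over the at most `3 n log T` queries makes failures
negligible.

Rates. The number `r` balances `n r`, which is the exploration time up to a logarithm and also
equals `T ε`, against the estimation loss `2 T k δ`. Both have the order of the claimed rate up to
logarithms. If `ε ≥ 1`, the trivial bound `T ≤ T ε = n r` suffices. -/

/-- The candidate, together with its answer, that `queryBest` passes on. -/
noncomputable def pickBest {V : Type} [DecidableEq V] (oracle : ℕ → Finset V → ℝ) (A : Finset V) :
    List V → ℕ → Option (V × ℝ) → Option (V × ℝ)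
  | [], _, best => best
  | a :: l, j, best => pickBest oracle A l (j + 1)
      (match best with
        | none => some (a, oracle j (insert a A))
        | some (b, z) =>
          if z < oracle j (insert a A) then some (a, oracle j (insert a A)) else some (b, z))

/-! ### Pathwise analysis of a run for an arbitrary oracle -/

section Deterministic

variable {V : Type} [DecidableEq V]

theorem run_queryBest (oracle : ℕ → Finset V → ℝ) (A : Finset V)
    (next : Option V → QueryAlgorithm V) (L : List V) (best : Option (V × ℝ)) (j : ℕ) :
    (queryBest A next L best).run oracle j =
      (L.map (fun a => insert a A) ++
        ((next ((pickBest oracle A L j best).map Prod.fst)).run oracle (j + L.length)).1,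
      ((next ((pickBest oracle A L j best).map Prod.fst)).run oracle (j + L.length)).2) := by
  induction L generalizing best j with
  | nil => simp [queryBest, pickBest]
  | cons a L ih =>
    simp only [queryBest, QueryAlgorithm.run, pickBest, List.map_cons, List.length_cons,
      List.cons_append]
    rw [show j + (L.length + 1) = j + 1 + L.length by ring]
    exact congrArg (fun p : List (Finset V) × Finset V => (insert a A :: p.1, p.2)) (ih _ (j + 1))

/-- Loop invariant of the maximum search: the leader's value never decreases and dominates every
answer seen. The final disjunction records where the leader came from. -/
theorem pickBest_some (oracle : ℕ → Finset V → ℝ) (A : Finset V) (L : List V) (j : ℕ)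
    (b : V) (z : ℝ) :
    ∃ c y, pickBest oracle A L j (some (b, z)) = some (c, y) ∧ z ≤ y ∧
      (∀ i (h : i < L.length), oracle (j + i) (insert L[i] A) ≤ y) ∧
      ((c = b ∧ y = z) ∨
        ∃ i, ∃ h : i < L.length, c = L[i] ∧ y = oracle (j + i) (insert L[i] A)) := by
  induction L generalizing j b z with
  | nil => exact ⟨b, z, rfl, le_rfl, by simp, Or.inl ⟨rfl, rfl⟩⟩
  | cons a L ih =>
    simp only [pickBest]
    -- Whoever wins the first comparison, the new leader's value dominates both competitors; this is
    -- all that the induction hypothesis needs, so the two branches are treated together.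
    have key : ∀ b' z', z ≤ z' → oracle j (insert a A) ≤ z' →
        ((b' = b ∧ z' = z) ∨ (b' = a ∧ z' = oracle j (insert a A))) →
        ∃ c y, pickBest oracle A L (j + 1) (some (b', z')) = some (c, y) ∧ z ≤ y ∧
      (∀ i (h : i < (a :: L).length), oracle (j + i) (insert (a :: L)[i] A) ≤ y) ∧
      ((c = b ∧ y = z) ∨
        ∃ i, ∃ h : i < (a :: L).length, c = (a :: L)[i] ∧
          y = oracle (j + i) (insert (a :: L)[i] A)) := by
      intro b' z' h1 h2 h3
      obtain ⟨c, y, e, hy, hall, hor⟩ := ih (j + 1) b' z'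
      refine ⟨c, y, e, h1.trans hy, ?_, ?_⟩
      · intro i hi
        rcases i with _ | i
        · simpa using h2.trans hy
        · have := hall i (by simpa using hi)
          rwa [show j + 1 + i = j + (i + 1) by ring] at this
      · rcases hor with ⟨rfl, rfl⟩ | ⟨i, hi, h4, h5⟩
        · rcases h3 with h3 | h3
          · exact Or.inl h3
          · exact Or.inr ⟨0, by simp, by simpa using h3⟩
        · refine Or.inr ⟨i + 1, by simpa using hi, by simpa using h4, ?_⟩
          rwa [show j + 1 + i = j + (i + 1) by ring] at h5
    split_ifs with h
    · exact key a _ h.le le_rfl (Or.inr ⟨rfl, rfl⟩)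
    · exact key b z le_rfl (not_lt.mp h) (Or.inl ⟨rfl, rfl⟩)

theorem pickBest_none (oracle : ℕ → Finset V → ℝ) (A : Finset V) (L : List V) (j : ℕ)
    (hL : L ≠ []) :
    ∃ i, ∃ h : i < L.length,
      pickBest oracle A L j none = some (L[i], oracle (j + i) (insert L[i] A)) ∧
      ∀ i' (h' : i' < L.length),
        oracle (j + i') (insert L[i'] A) ≤ oracle (j + i) (insert L[i] A) := by
  rcases L with _ | ⟨a, L⟩
  · exact absurd rfl hL
  obtain ⟨c, y, e, hy, hall, hor⟩ := pickBest_some oracle A L (j + 1) a (oracle j (insert a A))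
  have hmax : ∀ i' (h' : i' < (a :: L).length), oracle (j + i') (insert (a :: L)[i'] A) ≤ y := by
    intro i hi
    rcases i with _ | i
    · simpa using hy
    · have := hall i (by simpa using hi)
      rwa [show j + 1 + i = j + (i + 1) by ring] at this
  rcases hor with ⟨rfl, rfl⟩ | ⟨i, hi, rfl, rfl⟩
  · exact ⟨0, by simp, by simpa [pickBest] using e, by simpa using hmax⟩
  · refine ⟨i + 1, by simpa using hi, ?_, ?_⟩
    · simpa [pickBest, show j + 1 + i = j + (i + 1) by ring] using e
    · simpa [show j + 1 + i = j + (i + 1) by ring] using hmax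

/-- The current set after adding the selected candidate. -/
def addOption (A : Finset V) : Option V → Finset V
  | none => A
  | some a => insert a A

theorem run_stochasticGreedyFrom_succ (oracle : ℕ → Finset V → ℝ) (R : ℕ → Finset V → Finset V)
    (d l : ℕ) (A : Finset V) (j : ℕ) :
    (stochasticGreedyFrom R (d + 1) l A).run oracle j =
      ((R l A).toList.map (fun a => insert a A) ++
        ((stochasticGreedyFrom R d (l + 1)
          (addOption A ((pickBest oracle A (R l A).toList j none).map Prod.fst))).run oracle
            (j + (R l A).card)).1,
      ((stochasticGreedyFrom R d (l + 1)
          (addOption A ((pickBest oracle A (R l A).toList j none).map Prod.fst))).run oracle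
            (j + (R l A).card)).2) := by
  rw [stochasticGreedyFrom, run_queryBest, Finset.length_toList]
  rcases (pickBest oracle A (R l A).toList j none).map Prod.fst with _ | a <;> rfl

/-- The first `l` iterations of Stochastic-Greedy: the current set and the number of queries. -/
noncomputable def greedyState (oracle : ℕ → Finset V → ℝ) (R : ℕ → Finset V → Finset V) :
    ℕ → Finset V × ℕ
  | 0 => (∅, 0)
  | l + 1 =>
    (addOption (greedyState oracle R l).1
      ((pickBest oracle (greedyState oracle R l).1 (R l (greedyState oracle R l).1).toList
        (greedyState oracle R l).2 none).map Prod.fst),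
      (greedyState oracle R l).2 + (R l (greedyState oracle R l).1).card)

/-- The length of `pre` matters because it is the number of the next query: it matches positions in
the list of queried sets with the indices of the oracle. The number `d` of remaining iterations
varies in the induction, since the step splits off the first of `d + 1`. -/
theorem run_stochasticGreedy_add (oracle : ℕ → Finset V → ℝ) (R : ℕ → Finset V → Finset V)
    (l d : ℕ) :
    ∃ pre : List (Finset V), pre.length = (greedyState oracle R l).2 ∧
      (stochasticGreedy (l + d) R).run oracle 0 =
        (pre ++ ((stochasticGreedyFrom R d l (greedyState oracle R l).1).run oracle
            (greedyState oracle R l).2).1,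
          ((stochasticGreedyFrom R d l (greedyState oracle R l).1).run oracle
            (greedyState oracle R l).2).2) := by
  induction l generalizing d with
  | zero => exact ⟨[], rfl, by simp [greedyState, stochasticGreedy]⟩
  | succ l ih =>
    obtain ⟨pre, hpre, h⟩ := ih (d + 1)
    rw [run_stochasticGreedyFrom_succ] at h
    refine ⟨pre ++ (R l (greedyState oracle R l).1).toList.map
      (fun a => insert a (greedyState oracle R l).1), ?_, ?_⟩
    · simp [greedyState, hpre]
    · rw [show l + 1 + d = l + (d + 1) by ring, h]
      simp [greedyState]

theorem run_stochasticGreedy_snd (oracle : ℕ → Finset V → ℝ) (R : ℕ → Finset V → Finset V)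
    (k : ℕ) : ((stochasticGreedy k R).run oracle 0).2 = (greedyState oracle R k).1 := by
  obtain ⟨pre, -, h⟩ := run_stochasticGreedy_add oracle R k 0
  rw [add_zero] at h
  rw [h]; rfl

theorem length_run_stochasticGreedy (oracle : ℕ → Finset V → ℝ) (R : ℕ → Finset V → Finset V)
    (k : ℕ) : ((stochasticGreedy k R).run oracle 0).1.length = (greedyState oracle R k).2 := by
  obtain ⟨pre, hpre, h⟩ := run_stochasticGreedy_add oracle R k 0
  rw [add_zero] at h
  rw [h, ← hpre]; simp [stochasticGreedyFrom, QueryAlgorithm.run]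

theorem greedyState_snd_le (oracle : ℕ → Finset V → ℝ) (R : ℕ → Finset V → Finset V) (s : ℕ)
    (hR : ∀ l A, (R l A).card ≤ s) (l : ℕ) : (greedyState oracle R l).2 ≤ l * s := by
  induction l with
  | zero => simp [greedyState]
  | succ l ih =>
    simp only [greedyState, add_mul, one_mul]
    exact add_le_add ih (hR _ _)

theorem subset_addOption (A : Finset V) (o : Option V) : A ⊆ addOption A o := by
  rcases o with _ | a
  · exact subset_rfl
  · exact Finset.subset_insert a A

theorem card_addOption_le (A : Finset V) (o : Option V) : (addOption A o).card ≤ A.card + 1 := by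
  rcases o with _ | a
  · exact Nat.le_succ _
  · exact Finset.card_insert_le a A

theorem greedyState_subset_succ (oracle : ℕ → Finset V → ℝ) (R : ℕ → Finset V → Finset V)
    (l : ℕ) : (greedyState oracle R l).1 ⊆ (greedyState oracle R (l + 1)).1 :=
  subset_addOption _ _

/-- An iteration adds at most one element and queries sets with at most one element more. This keeps
all actions within the sets on which the rewards have mean `f` and values in `[0, 1]`. -/
theorem card_stochasticGreedyFrom_le (oracle : ℕ → Finset V → ℝ) (R : ℕ → Finset V → Finset V)
    (k d l : ℕ) (A : Finset V) (j : ℕ) (h : A.card + d ≤ k) :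
    (∀ B ∈ ((stochasticGreedyFrom R d l A).run oracle j).1, B.card ≤ k) ∧
      ((stochasticGreedyFrom R d l A).run oracle j).2.card ≤ k := by
  induction d generalizing l A j with
  | zero => simpa [stochasticGreedyFrom, QueryAlgorithm.run] using h
  | succ d ih =>
    rw [run_stochasticGreedyFrom_succ]
    have := ih (l + 1) (addOption A ((pickBest oracle A (R l A).toList j none).map Prod.fst))
      (j + (R l A).card) (by have := card_addOption_le A
                                ((pickBest oracle A (R l A).toList j none).map Prod.fst)
                             omega)
    refine ⟨?_, this.2⟩
    intro B hB
    rcases List.mem_append.mp hB with hB | hB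
    · obtain ⟨a, -, rfl⟩ := List.mem_map.mp hB
      have := Finset.card_insert_le a A
      omega
    · exact this.1 B hB

theorem card_getD_run_stochasticGreedy_le (oracle : ℕ → Finset V → ℝ)
    (R : ℕ → Finset V → Finset V) (k i : ℕ) :
    (((stochasticGreedy k R).run oracle 0).1.getD i
      ((stochasticGreedy k R).run oracle 0).2).card ≤ k := by
  obtain ⟨h1, h2⟩ := card_stochasticGreedyFrom_le oracle R k k 0 ∅ 0 (by simp)
  change ((((stochasticGreedyFrom R k 0 ∅).run oracle 0).1.getD i
      ((stochasticGreedyFrom R k 0 ∅).run oracle 0).2)).card ≤ k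
  rw [List.getD_eq_getElem?_getD]
  rcases h : ((stochasticGreedyFrom R k 0 ∅).run oracle 0).1[i]? with _ | B
  · simpa using h2
  · simpa using h1 B (List.mem_of_getElem? h)

omit [DecidableEq V] in
/-- The action with number `i` depends only on the answers to the earlier queries. -/
theorem getD_run_congr (o₁ o₂ : ℕ → Finset V → ℝ) (alg : QueryAlgorithm V) (j i : ℕ)
    (h : ∀ j' < j + i, o₁ j' = o₂ j') :
    (alg.run o₁ j).1.getD i (alg.run o₁ j).2 = (alg.run o₂ j).1.getD i (alg.run o₂ j).2 := by
  induction alg generalizing i j with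
  | output Θ => rfl
  | query A next ih =>
    rcases i with _ | i
    · simp [QueryAlgorithm.run]
    · simp only [QueryAlgorithm.run, List.getD_cons_succ]
      rw [h j (by omega)]
      exact ih _ (j + 1) i fun j' hj' => h j' (by omega)

/-- One iteration of Stochastic-Greedy is robust against errors of the answers. -/
theorem greedyState_succ_ge (oracle : ℕ → Finset V → ℝ) (R : ℕ → Finset V → Finset V)
    (f : Finset V → ℝ) (δ : ℝ) (k : ℕ)
    (h : ∀ i < ((stochasticGreedy k R).run oracle 0).1.length,
      |oracle i (((stochasticGreedy k R).run oracle 0).1.getD i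
        ((stochasticGreedy k R).run oracle 0).2) -
        f (((stochasticGreedy k R).run oracle 0).1.getD i
        ((stochasticGreedy k R).run oracle 0).2)| ≤ δ)
    (l : ℕ) (hl : l < k) (b : V) (hb : b ∈ R l (greedyState oracle R l).1) :
    f (insert b (greedyState oracle R l).1) ≤ f (greedyState oracle R (l + 1)).1 + 2 * δ := by
  obtain ⟨d, rfl⟩ := Nat.exists_eq_add_of_lt hl
  obtain ⟨pre, hpre, hrun⟩ := run_stochasticGreedy_add oracle R l (d + 1)
  rw [run_stochasticGreedyFrom_succ, ← add_assoc] at hrun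
  set A := (greedyState oracle R l).1 with hA
  set j := (greedyState oracle R l).2 with hj
  set L := (R l A).toList with hL
  -- The queries of iteration `l` occupy the positions from `j` on, just after `pre`, so the
  -- accuracy hypothesis on the whole run covers them.
  have hclean : ∀ i (hi : i < L.length),
      |oracle (j + i) (insert L[i] A) - f (insert L[i] A)| ≤ δ := by
    intro i hi
    have := h (j + i) (by rw [hrun]; simp [hpre]; omega)
    rw [hrun] at this
    simp only at this
    rwa [List.getD_eq_getElem?_getD, List.getElem?_append_right (by omega), hpre,
      Nat.add_sub_cancel_left, List.getElem?_append_left (by simpa using hi),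
      List.getElem?_map, List.getElem?_eq_getElem hi] at this
  have hbL : b ∈ L := by simpa [hL] using hb
  obtain ⟨i, hi, hpick, hmax⟩ := pickBest_none oracle A L j (List.ne_nil_of_mem hbL)
  obtain ⟨i', hi', rfl⟩ := List.getElem_of_mem hbL
  have hst : (greedyState oracle R (l + 1)).1 = insert L[i] A := by
    simp only [greedyState, ← hA, ← hj, ← hL, hpick]
    rfl
  rw [hst]
  have h1 := abs_le.mp (hclean i hi)
  have h2 := abs_le.mp (hclean i' hi')
  -- One `δ` is lost on the selected candidate and one on its competitor.
  linarith [hmax i' hi', h1.2, h2.1]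

end Deterministic

/-! ### Measurability of a run -/

section Measurability

variable {V : Type} [DecidableEq V] {Ω' : Type*} [MeasurableSpace Ω']

/-- The only random branching is the comparison of two real answers, so the identity `b` of the
leader stays deterministic while its value `z` varies with `ω`. Prefixing the new query is absorbed
into the arbitrary target set `S`. -/
theorem measurableSet_run_queryBest {oracle : ℕ → Finset V → Ω' → ℝ}
    (ho : ∀ j A, Measurable (oracle j A)) (A : Finset V) {next : Ω' → Option V → QueryAlgorithm V}
    (hnext : ∀ o j S, MeasurableSet
      {ω | (next ω o).run (fun i B => oracle i B ω) j ∈ (S : Set (List (Finset V) × Finset V))})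
    (L : List V) (b : Option V) {z : Ω' → ℝ} (hz : Measurable z) (j : ℕ)
    (S : Set (List (Finset V) × Finset V)) :
    MeasurableSet {ω | (queryBest A (next ω) L (b.map fun c => (c, z ω))).run
      (fun i B => oracle i B ω) j ∈ S} := by
  induction L generalizing b z j S with
  | nil =>
    have h : ∀ ω, (b.map fun c => (c, z ω)).map Prod.fst = b := fun ω => by
      rcases b with _ | b <;> rfl
    simp only [queryBest, h]
    exact hnext b j S
  | cons a L ih =>
    set y := oracle j (insert a A) with hy
    set S' : Set (List (Finset V) × Finset V) := {p | (insert a A :: p.1, p.2) ∈ S} with hS'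
    have hnew := ih (some a) (ho j (insert a A)) (j + 1) S'
    rcases b with _ | b
    · exact hnew
    · have hold := ih (some b) hz (j + 1) S'
      have hlt : MeasurableSet {ω | z ω < y ω} := measurableSet_lt hz (ho _ _)
      convert (hlt.inter hnew).union (hlt.compl.inter hold) using 1
      ext ω
      by_cases hω : z ω < y ω
      · have hω' := hω
        simp only [hy] at hω'
        simp [queryBest, QueryAlgorithm.run, hω', hS', hy]
      · have hω' := hω
        simp only [hy] at hω'
        simp [queryBest, QueryAlgorithm.run, hω', hS', hy]

/-- Conditioning on the value of a sample makes the candidate list deterministic. Samples are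
required to be measurable only for the iterations actually executed, so the result applies to the
σ-algebra of the randomness preceding a given iteration. -/
theorem measurableSet_run_stochasticGreedyFrom [Fintype V] {oracle : ℕ → Finset V → Ω' → ℝ}
    (ho : ∀ j A, Measurable (oracle j A)) {R : ℕ → Finset V → Ω' → Finset V} (d l : ℕ)
    (hR : ∀ l' < l + d, ∀ A B, MeasurableSet {ω | R l' A ω = B}) (A : Finset V) (j : ℕ)
    (S : Set (List (Finset V) × Finset V)) :
    MeasurableSet {ω | (stochasticGreedyFrom (fun l' A => R l' A ω) d l A).run
      (fun i B => oracle i B ω) j ∈ S} := by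
  induction d generalizing l A j S with
  | zero =>
    simp only [stochasticGreedyFrom, QueryAlgorithm.run]
    exact MeasurableSet.const _
  | succ d ih =>
    have hnext := fun A' => ih (l + 1) (fun l' hl' => hR l' (by omega)) A'
    have key : ∀ B : Finset V, MeasurableSet {ω | (queryBest A
        (fun best => match best with
          | none => stochasticGreedyFrom (fun l' A => R l' A ω) d (l + 1) A
          | some a => stochasticGreedyFrom (fun l' A => R l' A ω) d (l + 1) (insert a A))
        B.toList none).run (fun i B => oracle i B ω) j ∈ S} := by
      intro B
      refine measurableSet_run_queryBest ho A ?_ B.toList none (z := fun _ => 0)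
        measurable_const j S
      intro o j S
      rcases o with _ | a
      · exact hnext A j S
      · exact hnext (insert a A) j S
    have : {ω | (stochasticGreedyFrom (fun l' A => R l' A ω) (d + 1) l A).run
      (fun i B => oracle i B ω) j ∈ S} = ⋃ B : Finset V, ({ω | R l A ω = B} ∩ {ω | (queryBest A
        (fun best => match best with
          | none => stochasticGreedyFrom (fun l' A => R l' A ω) d (l + 1) A
          | some a => stochasticGreedyFrom (fun l' A => R l' A ω) d (l + 1) (insert a A))
        B.toList none).run (fun i B => oracle i B ω) j ∈ S}) := by
      ext ω
      simp only [stochasticGreedyFrom, Set.mem_ofPred_eq, Set.mem_iUnion, Set.mem_inter_iff]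
      constructor
      · exact fun h => ⟨_, rfl, h⟩
      · rintro ⟨B, rfl, h⟩
        exact h
    rw [this]
    exact MeasurableSet.iUnion fun B => (hR l (by omega) A B).inter (key B)

theorem measurableSet_run_stochasticGreedy [Fintype V] {oracle : ℕ → Finset V → Ω' → ℝ}
    (ho : ∀ j A, Measurable (oracle j A)) {R : ℕ → Finset V → Ω' → Finset V} (k : ℕ)
    (hR : ∀ l < k, ∀ A B, MeasurableSet {ω | R l A ω = B})
    (S : Set (List (Finset V) × Finset V)) :
    MeasurableSet {ω | (stochasticGreedy k (fun l A => R l A ω)).run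
      (fun i B => oracle i B ω) 0 ∈ S} :=
  measurableSet_run_stochasticGreedyFrom ho k 0 (by simpa using hR) ∅ 0 S

end Measurability

/-! ### Submodularity and uniform sampling without replacement -/

section Combinatorics

variable {V : Type} [DecidableEq V]

theorem sub_le_sum_gain {f : Finset V → ℝ} (hmono : Monotone f) (hsub : IsSubmodularFn f)
    (A U : Finset V) : f (A ∪ U) - f A ≤ ∑ u ∈ U, (f (insert u A) - f A) := by
  induction U using Finset.induction_on with
  | empty => simp
  | insert u U hu ih =>
    rw [Finset.sum_insert hu, Finset.union_insert]
    by_cases h : u ∈ A ∪ U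
    · rw [Finset.insert_eq_of_mem h]
      have : f A ≤ f (insert u A) := hmono (Finset.subset_insert u A)
      linarith
    · have := hsub A (A ∪ U) Finset.subset_union_left u h
      linarith

/-- Sampling without replacement misses `u` given elements at most as often as sampling with
replacement: the ratio of consecutive binomials is `(N - u - s)/(N - u) ≤ 1 - s/N`. -/
theorem choose_sub_le_pow_mul_choose (N s : ℕ) (hs : s ≤ N) (u : ℕ) (hu : u ≤ N) :
    ((N - u).choose s : ℝ) ≤ (1 - (s : ℝ) / N) ^ u * (N.choose s : ℝ) := by
  induction u with
  | zero => simp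
  | succ u ih =>
    have ih := ih (by omega)
    have hN : (0 : ℝ) < N := by exact_mod_cast (by omega : 0 < N)
    have hsN : (s : ℝ) ≤ N := by exact_mod_cast hs
    have hu' : (0 : ℝ) < (N : ℝ) - u := by
      have : (u : ℝ) + 1 ≤ N := by exact_mod_cast hu
      linarith
    have hfac : 0 ≤ 1 - (s : ℝ) / N := by rw [sub_nonneg, div_le_one hN]; exact hsN
    have h1 := Nat.choose_mul_succ_eq (N - (u + 1)) s
    rw [show N - (u + 1) + 1 = N - u by omega] at h1
    have h2 : ((N - (u + 1)).choose s : ℝ) * ((N : ℝ) - u) ≤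
        ((N - u).choose s : ℝ) * ((1 - (s : ℝ) / N) * ((N : ℝ) - u)) := by
      have h3 : ((N - (u + 1)).choose s : ℝ) * ((N - u : ℕ) : ℝ) =
        ((N - u).choose s : ℝ) * ((N - u - s : ℕ) : ℝ) := by exact_mod_cast h1
      rw [Nat.cast_sub (by omega)] at h3
      rw [h3]
      rcases le_or_gt s (N - u) with h | h
      · rw [Nat.cast_sub h, Nat.cast_sub (by omega)]
        refine mul_le_mul_of_nonneg_left ?_ (Nat.cast_nonneg _)
        have : (s : ℝ) / N * u ≤ s := by
          rw [div_mul_eq_mul_div, div_le_iff₀ hN]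
          exact mul_le_mul_of_nonneg_left (by linarith) (Nat.cast_nonneg _)
        have h5 : (s : ℝ) / N * N = s := div_mul_cancel₀ _ hN.ne'
        nlinarith
      · simp [Nat.choose_eq_zero_of_lt h]
    rw [← mul_assoc] at h2
    have h4 := le_of_mul_le_mul_right h2 hu'
    calc ((N - (u + 1)).choose s : ℝ) ≤ ((N - u).choose s : ℝ) * (1 - (s : ℝ) / N) := h4
      _ ≤ (1 - (s : ℝ) / N) ^ u * (N.choose s : ℝ) * (1 - (s : ℝ) / N) :=
        mul_le_mul_of_nonneg_right ih hfac
      _ = _ := by ring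

/-- The probability that a sample of Stochastic-Greedy misses a set of `u` elements. -/
theorem one_sub_min_div_pow_le {n k N s u : ℕ} {ε : ℝ} (hu : 1 ≤ u) (huk : u ≤ k) (huN : u ≤ N)
    (hNn : N ≤ n) (hε : 0 < ε) (hε1 : ε < 1) (hs : (n : ℝ) / k * Real.log (1 / ε) ≤ s) :
    (1 - ((min s N : ℕ) : ℝ) / N) ^ u ≤ 1 - (1 - ε) * (u / k) := by
  have hk : (0 : ℝ) < k := by exact_mod_cast (by omega : 0 < k)
  have hN : (0 : ℝ) < N := by exact_mod_cast (by omega : 0 < N)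
  have hn : (0 : ℝ) < n := by exact_mod_cast (by omega : 0 < n)
  have hx0 : (0 : ℝ) ≤ u / k := by positivity
  have hx1 : (u : ℝ) / k ≤ 1 := by rw [div_le_one hk]; exact_mod_cast huk
  -- If `s ≥ N`, everything is sampled and the miss probability is `0`, because `u ≥ 1`.
  rcases le_or_gt N s with h | h
  · rw [min_eq_right h, div_self hN.ne', sub_self, zero_pow (by omega)]
    nlinarith
  · rw [min_eq_left h.le]
    have hlog : 0 ≤ Real.log (1 / ε) := Real.log_nonneg (by rw [le_div_iff₀ hε]; linarith)
    have h1 : (1 : ℝ) - s / N ≤ Real.exp (-(Real.log (1 / ε) / k)) := by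
      have hsN : Real.log (1 / ε) / k ≤ s / N := by
        rw [div_le_div_iff₀ hk hN]
        have h3 : (n : ℝ) * Real.log (1 / ε) ≤ s * k := by
          rwa [div_mul_eq_mul_div, div_le_iff₀ hk] at hs
        have h4 : (N : ℝ) ≤ n := by exact_mod_cast hNn
        nlinarith
      have := Real.add_one_le_exp (-(Real.log (1 / ε) / k))
      have h2 := Real.one_sub_le_exp_neg ((s : ℝ) / N)
      exact h2.trans (Real.exp_le_exp.mpr (by linarith))
    have h0 : (0 : ℝ) ≤ 1 - s / N := by
      rw [sub_nonneg, div_le_one hN]; exact_mod_cast h.le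
    calc ((1 : ℝ) - s / N) ^ u ≤ Real.exp (-(Real.log (1 / ε) / k)) ^ u :=
          pow_le_pow_left₀ h0 h1 u
      _ = ε ^ ((u : ℝ) / k) := by
        rw [← Real.exp_nat_mul, Real.rpow_def_of_pos hε, one_div, Real.log_inv]
        congr 1
        ring
      -- The factor `1` prepares the weighted AM-GM inequality, which bounds the convex function `x
      -- ↦ ε ^ x` on `[0, 1]` by its chord.
      _ = ε ^ ((u : ℝ) / k) * 1 ^ (1 - (u : ℝ) / k) := by rw [Real.one_rpow, mul_one]
      _ ≤ (u : ℝ) / k * ε + (1 - (u : ℝ) / k) * 1 :=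
        Real.geom_mean_le_arith_mean2_weighted hx0 (by linarith) hε.le zero_le_one (by ring)
      _ = _ := by ring

/-- The largest value of `f` that can be reached from `A` by adding at most one element of `R`. -/
noncomputable def bestValue (f : Finset V → ℝ) (A R : Finset V) : ℝ :=
  (insert A (R.image fun b => insert b A)).sup' (Finset.insert_nonempty _ _) f

theorem le_bestValue_self (f : Finset V → ℝ) (A R : Finset V) : f A ≤ bestValue f A R :=
  Finset.le_sup' f (Finset.mem_insert_self _ _)

theorem le_bestValue (f : Finset V → ℝ) (A R : Finset V) {b : V} (hb : b ∈ R) :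
    f (insert b A) ≤ bestValue f A R :=
  Finset.le_sup' f (Finset.mem_insert_of_mem (Finset.mem_image_of_mem (fun b => insert b A) hb))

theorem bestValue_le {f : Finset V → ℝ} {A R : Finset V} {c : ℝ} (h : f A ≤ c)
    (h' : ∀ b ∈ R, f (insert b A) ≤ c) : bestValue f A R ≤ c := by
  refine Finset.sup'_le _ _ fun B hB => ?_
  rcases Finset.mem_insert.mp hB with rfl | hB
  · exact h
  · obtain ⟨b, hb, rfl⟩ := Finset.mem_image.mp hB
    exact h' b hb

/-- In a uniformly random sample of a fixed size, all elements of `U` play the same role. -/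
theorem sum_inv_card_inter_eq (W U : Finset V) (hU : U ⊆ W) (s : ℕ) {u v : V} (hu : u ∈ U)
    (hv : v ∈ U) :
    ∑ R ∈ powersetCard s W with u ∈ R, ((R ∩ U).card : ℝ)⁻¹ =
      ∑ R ∈ powersetCard s W with v ∈ R, ((R ∩ U).card : ℝ)⁻¹ := by
  -- The transposition of `u` and `v` fixes `W` and `U`, so it exchanges samples containing `u` with
  -- samples containing `v` and preserves `|R ∩ U|`.
  have hmap : ∀ Z : Finset V, u ∈ Z → v ∈ Z → Z.map (Equiv.swap u v).toEmbedding = Z := by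
    intro Z h1 h2
    refine Finset.eq_of_subset_of_card_le ?_ (by simp)
    intro x hx
    obtain ⟨y, hy, rfl⟩ := Finset.mem_map.mp hx
    simp only [Equiv.coe_toEmbedding, Equiv.swap_apply_def]
    split_ifs <;> assumption
  refine Finset.sum_nbij' (fun R => R.map (Equiv.swap u v).toEmbedding)
    (fun R => R.map (Equiv.swap u v).toEmbedding) ?_ ?_ ?_ ?_ ?_
  · intro R hR
    simp only [Finset.mem_filter, Finset.mem_powersetCard, Finset.card_map] at hR ⊢
    refine ⟨⟨?_, hR.1.2⟩, Finset.mem_map.mpr ⟨u, hR.2, by simp⟩⟩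
    rw [← hmap W (hU hu) (hU hv)]
    exact Finset.map_subset_map.mpr hR.1.1
  · intro R hR
    simp only [Finset.mem_filter, Finset.mem_powersetCard, Finset.card_map] at hR ⊢
    refine ⟨⟨?_, hR.1.2⟩, Finset.mem_map.mpr ⟨v, hR.2, by simp⟩⟩
    rw [← hmap W (hU hu) (hU hv)]
    exact Finset.map_subset_map.mpr hR.1.1
  · intro R _
    ext x
    simp [Finset.mem_map_equiv]
  · intro R _
    ext x
    simp [Finset.mem_map_equiv]
  · intro R _
    congr 2
    nth_rewrite 2 [← hmap U hu hv]
    rw [← Finset.map_inter, Finset.card_map]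

/-- The expected gain of one iteration of Stochastic-Greedy, for a fixed current set. -/
theorem sum_bestValue_ge [Fintype V] {f : Finset V → ℝ} (hmono : Monotone f)
    (hsub : IsSubmodularFn f) {k : ℕ} {ε : ℝ} (hε : 0 < ε) (hε1 : ε < 1) (A S : Finset V)
    (hS : S.card ≤ k) {s : ℕ} (hs : (Fintype.card V : ℝ) / k * Real.log (1 / ε) ≤ s) :
    (powersetCard (min s (Aᶜ).card) Aᶜ).card * ((1 - ε) / k * (f S - f A)) ≤
      ∑ R ∈ powersetCard (min s (Aᶜ).card) Aᶜ, (bestValue f A R - f A) := by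
  set W := Aᶜ with hW
  set t := min s W.card with ht
  set U := S \ A with hUdef
  set g : V → ℝ := fun u => f (insert u A) - f A with hg
  have hg0 : ∀ u, 0 ≤ g u := fun u => sub_nonneg.mpr (hmono (Finset.subset_insert u A))
  have hUW : U ⊆ W := fun x hx => by
    rw [hW, Finset.mem_compl]; exact (Finset.mem_sdiff.mp hx).2
  have hUk : U.card ≤ k := (Finset.card_le_card Finset.sdiff_subset).trans hS
  have hsum : f S - f A ≤ ∑ u ∈ U, g u := by
    refine le_trans (sub_le_sub_right (hmono ?_) _) (sub_le_sum_gain hmono hsub A U)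
    intro x hx
    by_cases h : x ∈ A <;> simp [hUdef, h, hx]
  have hnn : ∀ R, 0 ≤ bestValue f A R - f A := fun R => sub_nonneg.mpr (le_bestValue_self f A R)
  rcases U.eq_empty_or_nonempty with hU | ⟨u₀, hu₀⟩
  · rw [hU, Finset.sum_empty] at hsum
    refine le_trans (mul_nonpos_of_nonneg_of_nonpos (Nat.cast_nonneg _)
      (mul_nonpos_of_nonneg_of_nonpos (div_nonneg (by linarith) (Nat.cast_nonneg _)) hsum))
      (Finset.sum_nonneg fun R _ => hnn R)
  have hU1 : 1 ≤ U.card := Finset.card_pos.mpr ⟨u₀, hu₀⟩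
  have hk : (0 : ℝ) < k := by exact_mod_cast (by omega : 0 < k)
  -- Up to normalization, `w` is the probability that a uniform element of `R ∩ U` equals `u₀`; by
  -- symmetry it does not depend on `u₀ ∈ U`.
  set w : ℝ := ∑ R ∈ powersetCard t W with u₀ ∈ R, ((R ∩ U).card : ℝ)⁻¹ with hw
  have hswap : ∀ c : V → ℝ,
      ∑ R ∈ powersetCard t W, ∑ u ∈ R ∩ U, ((R ∩ U).card : ℝ)⁻¹ * c u = w * ∑ u ∈ U, c u := by
    intro c
    have h1 : ∀ R ∈ powersetCard t W, ∑ u ∈ R ∩ U, ((R ∩ U).card : ℝ)⁻¹ * c u =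
        ∑ u ∈ U, if u ∈ R then ((R ∩ U).card : ℝ)⁻¹ * c u else 0 := by
      intro R _
      rw [← Finset.sum_filter]
      refine Finset.sum_congr ?_ fun _ _ => rfl
      ext x; simp [and_comm]
    rw [Finset.sum_congr rfl h1, Finset.sum_comm, Finset.mul_sum]
    refine Finset.sum_congr rfl fun u hu => ?_
    rw [← Finset.sum_filter, ← Finset.sum_mul, hw, sum_inv_card_inter_eq W U hUW t hu hu₀]
  -- The best candidate is at least as good as the average over `R ∩ U`.
  have hlow : ∑ R ∈ powersetCard t W, ∑ u ∈ R ∩ U, ((R ∩ U).card : ℝ)⁻¹ * g u ≤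
      ∑ R ∈ powersetCard t W, (bestValue f A R - f A) := by
    refine Finset.sum_le_sum fun R _ => ?_
    rcases (R ∩ U).eq_empty_or_nonempty with h | h
    · rw [h, Finset.sum_empty]; exact hnn R
    · rw [← Finset.mul_sum, inv_mul_le_iff₀ (by exact_mod_cast h.card_pos), ← nsmul_eq_mul]
      refine Finset.sum_le_card_nsmul _ _ _ fun u hu => ?_
      exact sub_le_sub_right (le_bestValue f A R (Finset.mem_inter.mp hu).1) _
  -- Summing `w` over `U` counts the samples that meet `U`, i.e. all samples minus those contained
  -- in `W \ U`.
  have hcount : w * U.card = (powersetCard t W).card - ((W.card - U.card).choose t : ℝ) := by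
    have h1 := hswap fun _ => 1
    simp only [mul_one, Finset.sum_const, nsmul_eq_mul] at h1
    rw [← h1]
    have h2 : ∀ R ∈ powersetCard t W, ((R ∩ U).card : ℝ) * ((R ∩ U).card : ℝ)⁻¹ =
        1 - if R ∩ U = ∅ then 1 else 0 := by
      intro R _
      split_ifs with h
      · simp [h]
      · rw [mul_inv_cancel₀, sub_zero]
        exact_mod_cast (Finset.card_pos.mpr (Finset.nonempty_iff_ne_empty.mpr h)).ne'
    rw [Finset.sum_congr rfl h2, Finset.sum_sub_distrib, Finset.sum_const, nsmul_eq_mul, mul_one,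
      ← Finset.sum_filter, Finset.sum_const, nsmul_eq_mul, mul_one, ← Finset.card_sdiff_of_subset hUW,
      ← Finset.card_powersetCard]
    congr 3
    ext R
    simp only [Finset.mem_filter, Finset.mem_powersetCard, Finset.subset_sdiff,
      Finset.disjoint_iff_inter_eq_empty]
    tauto
  have hmiss := choose_sub_le_pow_mul_choose W.card t (min_le_right _ _) U.card
    (Finset.card_le_card hUW)
  have hp := one_sub_min_div_pow_le (n := Fintype.card V) (s := s) hU1 hUk
    (Finset.card_le_card hUW) (Finset.card_le_univ W) hε hε1 hs
  rw [Finset.card_powersetCard] at hcount ⊢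
  have hC : (0 : ℝ) ≤ (W.card.choose t : ℝ) := Nat.cast_nonneg _
  have hwge : (W.card.choose t : ℝ) * ((1 - ε) / k) ≤ w := by
    have hUpos : (0 : ℝ) < U.card := by exact_mod_cast hU1
    refine le_of_mul_le_mul_right ?_ hUpos
    rw [hcount]
    have h3 := hmiss.trans (mul_le_mul_of_nonneg_right hp hC)
    have h4 : (W.card.choose t : ℝ) * ((1 - ε) / k) * U.card =
      (1 - ε) * (U.card / k) * (W.card.choose t : ℝ) := by ring
    rw [h4]
    linarith
  calc (W.card.choose t : ℝ) * ((1 - ε) / k * (f S - f A))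
      ≤ (W.card.choose t : ℝ) * ((1 - ε) / k * ∑ u ∈ U, g u) := by
        refine mul_le_mul_of_nonneg_left (mul_le_mul_of_nonneg_left hsum ?_) hC
        exact div_nonneg (by linarith) hk.le
    _ = (W.card.choose t : ℝ) * ((1 - ε) / k) * ∑ u ∈ U, g u := by ring
    _ ≤ w * ∑ u ∈ U, g u :=
      mul_le_mul_of_nonneg_right hwge (Finset.sum_nonneg fun u _ => hg0 u)
    _ = _ := (hswap g).symm
    _ ≤ _ := hlow

end Combinatorics

/-! ### Freezing independent variables, and the greedy recursion in expectation -/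

section Probability

/-- A finitely valued random variable can be replaced by its values in expectations of independent
random variables. -/
theorem integral_comp_of_indep {Ω' ι : Type*} [Fintype ι] {F G : MeasurableSpace Ω'}
    [m0 : MeasurableSpace Ω'] {μ : Measure Ω'} [IsProbabilityMeasure μ] (hF : F ≤ m0)
    (hFG : Indep F G μ) {Y : Ω' → ι} (hY : ∀ a, MeasurableSet[F] {ω | Y ω = a})
    {Z : ι → Ω' → ℝ} (hZ : ∀ a, Measurable[G] (Z a)) (hint : ∀ a, Integrable (Z a) μ) :
    Integrable (fun ω => Z (Y ω) ω) μ ∧ Integrable (fun ω => ∫ ω', Z (Y ω) ω' ∂μ) μ ∧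
      ∫ ω, Z (Y ω) ω ∂μ = ∫ ω, ∫ ω', Z (Y ω) ω' ∂μ ∂μ := by
  classical
  -- Expanding over the values of `Y` gives `Z (Y ω) ω = ∑ a, I a ω * Z a ω`, and each product
  -- factorizes by independence.
  set I : ι → Ω' → ℝ := fun a => Set.indicator {ω | Y ω = a} fun _ => 1 with hI
  have hIm : ∀ a, Measurable[F] (I a) := fun a =>
    Measurable.indicator (m := F) (@measurable_const _ _ _ F _) (hY a)
  have hIi : ∀ a, Integrable (I a) μ := fun a =>
    (integrable_const (1 : ℝ)).indicator (hF _ (hY a))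
  have hindep : ∀ a, IndepFun (I a) (Z a) μ := fun a => by
    rw [IndepFun_iff_Indep]
    exact indep_of_indep_of_le_left (indep_of_indep_of_le_right hFG (hZ a).comap_le)
      (hIm a).comap_le
  have hsum : ∀ c : ι → ℝ, ∀ ω, c (Y ω) = ∑ a, I a ω * c a := by
    intro c ω
    rw [Finset.sum_eq_single (Y ω)]
    · simp [hI]
    · intro b _ hb
      simp [hI, Ne.symm hb]
    · simp
  have h1 : (fun ω => Z (Y ω) ω) = fun ω => ∑ a, I a ω * Z a ω :=
    funext fun ω => hsum (fun a => Z a ω) ω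
  have h2 : (fun ω => ∫ ω', Z (Y ω) ω' ∂μ) = fun ω => ∑ a, I a ω * ∫ ω', Z a ω' ∂μ :=
    funext fun ω => hsum (fun a => ∫ ω', Z a ω' ∂μ) ω
  have hi1 : ∀ a, Integrable (fun ω => I a ω * Z a ω) μ := fun a =>
    (hindep a).integrable_mul (hIi a) (hint a)
  have hi2 : ∀ a, Integrable (fun ω => I a ω * ∫ ω', Z a ω' ∂μ) μ := fun a =>
    (hIi a).mul_const _
  rw [h1, h2]
  refine ⟨integrable_finsetSum _ fun a _ => hi1 a, integrable_finsetSum _ fun a _ => hi2 a, ?_⟩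
  rw [integral_finsetSum _ fun a _ => hi1 a, integral_finsetSum _ fun a _ => hi2 a]
  refine Finset.sum_congr rfl fun a _ => ?_
  rw [integral_mul_const]
  exact (hindep a).integral_fun_mul_eq_mul_integral (hIi a).aestronglyMeasurable
    (hint a).aestronglyMeasurable

variable {Ω' : Type*} [m0 : MeasurableSpace Ω'] {μ : Measure Ω'} [IsProbabilityMeasure μ]
  {V : Type}

/-- The atoms in `F` already carry total mass `1`. -/
theorem IsUniformSet.ae_mem {Y : Ω' → Finset V} {F : Finset (Finset V)}
    (h : IsUniformSet μ Y F) : ∀ᵐ ω ∂μ, Y ω ∈ F := by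
  obtain ⟨hm, hne, hu⟩ := h
  have hmF : MeasurableSet (⋃ B ∈ F, Y ⁻¹' {B}) :=
    Finset.measurableSet_biUnion _ fun B _ => hm B
  have h1 : μ (⋃ B ∈ F, Y ⁻¹' {B}) = 1 := by
    rw [measure_biUnion_finset]
    · rw [Finset.sum_congr rfl hu, Finset.sum_const, nsmul_eq_mul]
      exact ENNReal.mul_inv_cancel (by simpa using hne.ne_empty) (ENNReal.natCast_ne_top _)
    · intro B _ B' _ hBB'
      exact Disjoint.preimage _ (by simpa using hBB')
    · exact fun B _ => hm B
  have h2 := (prob_compl_eq_zero_iff hmF).mpr h1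
  filter_upwards [measure_eq_zero_iff_ae_notMem.mp h2] with ω hω
  simpa using hω

theorem IsUniformSet.integral_eq [Fintype V] {Y : Ω' → Finset V} {F : Finset (Finset V)}
    (h : IsUniformSet μ Y F) (g : Finset V → ℝ) :
    ∫ ω, g (Y ω) ∂μ = (F.card : ℝ)⁻¹ * ∑ B ∈ F, g B := by
  classical
  have h1 : ∫ ω, g (Y ω) ∂μ = ∫ ω, ∑ B ∈ F, (Y ⁻¹' {B}).indicator (fun _ => g B) ω ∂μ := by
    refine integral_congr_ae ?_
    filter_upwards [h.ae_mem] with ω hω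
    rw [Finset.sum_eq_single_of_mem (Y ω) hω]
    · simp
    · intro B _ hB
      simp [Ne.symm hB]
  rw [h1, integral_finsetSum _ fun B _ => (integrable_const _).indicator (h.1 B), Finset.mul_sum]
  refine Finset.sum_congr rfl fun B hB => ?_
  rw [integral_indicator_const _ (h.1 B), measureReal_def, h.2.2 B hB]
  simp

omit [IsProbabilityMeasure μ] in
theorem IsGreedySampling.greedySigma_le [Fintype V] [DecidableEq V] {s : ℕ}
    {R : ℕ → Finset V → Ω' → Finset V} (h : IsGreedySampling μ s R) (l : ℕ) :
    greedySigma R l ≤ m0 := by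
  rintro _ ⟨S, -, rfl⟩
  have : (fun ω A => R l A ω) ⁻¹' S = ⋃ φ ∈ S, ⋂ A, R l A ⁻¹' {φ A} := by
    ext ω
    simp only [Set.mem_preimage, Set.mem_iUnion, Set.mem_iInter, Set.mem_singleton_iff]
    constructor
    · exact fun hω => ⟨_, hω, fun A => rfl⟩
    · rintro ⟨φ, hφ, hω⟩
      rwa [show (fun A => R l A ω) = φ from funext hω]
  rw [this]
  exact MeasurableSet.biUnion (Set.to_countable S) fun φ _ =>
    MeasurableSet.iInter fun A => (h l A).1 _

omit m0 in
theorem measurableSet_greedySigma (R : ℕ → Finset V → Ω' → Finset V) (l : ℕ) (A : Finset V)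
    (S : Set (Finset V)) : MeasurableSet[greedySigma R l] {ω | R l A ω ∈ S} :=
  ⟨{φ | φ A ∈ S}, trivial, rfl⟩

/-- Convexity gives `exp ε ≤ ε * e + (1 - ε)`; divide by `e`. -/
theorem exp_neg_one_sub_le {ε : ℝ} (hε : 0 ≤ ε) (hε1 : ε ≤ 1) :
    Real.exp (-(1 - ε)) ≤ 1 / Real.exp 1 + ε := by
  have h := Real.geom_mean_le_arith_mean2_weighted hε (sub_nonneg.mpr hε1) (Real.exp_pos 1).le
    zero_le_one (by ring)
  rw [Real.one_rpow, mul_one, mul_one, Real.exp_one_rpow] at h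
  rw [show -(1 - ε) = ε - 1 by ring, Real.exp_sub, div_le_iff₀ (Real.exp_pos 1), add_mul,
    one_div_mul_cancel (Real.exp_pos 1).ne']
  linarith

/-- The guarantee of a greedy algorithm that, in each of its `k` iterations, gains up to `η` as
much as the best element of a random sample. -/
theorem integral_greedy_ge [Fintype V] [DecidableEq V] {f : Finset V → ℝ} (hmono : Monotone f)
    (hsub : IsSubmodularFn f) (hf : 0 ≤ f ∅) {k : ℕ} (hk : 1 ≤ k) {ε : ℝ} (hε : 0 < ε)
    (hε1 : ε < 1) {R : ℕ → Finset V → Ω' → Finset V}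
    (hR : IsGreedySampling μ (sampleSize (Fintype.card V) k ε) R) {H : ℕ → MeasurableSpace Ω'}
    (hH : ∀ l, H l ≤ m0) (hind : ∀ l, Indep (H l) (greedySigma R l) μ)
    {A : ℕ → Ω' → Finset V} (hA0 : ∀ ω, A 0 ω = ∅)
    (hA : ∀ l B, MeasurableSet[H l] {ω | A l ω = B}) {η : Ω' → ℝ} (hη : Integrable η μ)
    (hη0 : ∀ ω, 0 ≤ η ω)
    (hstep : ∀ᵐ ω ∂μ, ∀ l < k, bestValue f (A l ω) (R l (A l ω) ω) ≤ f (A (l + 1) ω) + η ω)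
    (S : Finset V) (hS : S.card ≤ k) :
    (1 - 1 / Real.exp 1 - ε) * f S - k * ∫ ω, η ω ∂μ ≤ ∫ ω, f (A k ω) ∂μ := by
  have hk' : (0 : ℝ) < k := by exact_mod_cast hk
  have hk1 : (1 : ℝ) ≤ k := by exact_mod_cast hk
  set c : ℝ := (1 - ε) / k with hc
  have hc0 : 0 ≤ 1 - c := by
    rw [sub_nonneg, hc, div_le_one hk']; linarith
  set e : ℝ := ∫ ω, η ω ∂μ with he
  have he0 : 0 ≤ e := integral_nonneg hη0
  have hfi : ∀ l, Integrable (fun ω => f (A l ω)) μ := fun l =>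
    (integral_comp_of_indep (Z := fun B _ => f B) (hH l) (hind l) (hA l)
      (fun B => @measurable_const _ _ _ (greedySigma R l) _) fun B => integrable_const _).1
  set a : ℕ → ℝ := fun l => ∫ ω, f (A l ω) ∂μ with ha
  have hmeas : ∀ l B, Measurable[greedySigma R l] (fun ω => bestValue f B (R l B ω)) := by
    intro l B T _
    exact measurableSet_greedySigma R l B {C | bestValue f B C ∈ T}
  have hbi : ∀ l B, Integrable (fun ω => bestValue f B (R l B ω)) μ := by
    intro l B
    refine Integrable.of_bound ((hmeas l B).mono (hR.greedySigma_le l) le_rfl).aestronglyMeasurable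
      (∑ C : Finset V, |bestValue f B C|) (ae_of_all _ fun ω => ?_)
    exact Finset.single_le_sum (f := fun C => |bestValue f B C|) (fun _ _ => abs_nonneg _)
      (Finset.mem_univ _)
  have hgain : ∀ l B, f B + c * (f S - f B) ≤ ∫ ω, bestValue f B (R l B ω) ∂μ := by
    intro l B
    have hU := hR l B
    rw [hU.integral_eq (bestValue f B)]
    have h := sum_bestValue_ge hmono hsub hε hε1 B S hS
      (Nat.le_ceil ((Fintype.card V : ℝ) / k * Real.log (1 / ε)))
    change (#(powersetCard (min (sampleSize (Fintype.card V) k ε) #Bᶜ) Bᶜ) : ℝ) * _ ≤ ∑ R ∈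
      powersetCard (min (sampleSize (Fintype.card V) k ε) #Bᶜ) Bᶜ, _ at h
    set F := powersetCard (min (sampleSize (Fintype.card V) k ε) #Bᶜ) Bᶜ
    have hF : (0 : ℝ) < F.card := by exact_mod_cast hU.2.1.card_pos
    rw [Finset.sum_sub_distrib, Finset.sum_const, nsmul_eq_mul] at h
    rw [inv_mul_eq_div, le_div_iff₀ hF]
    linarith
  -- The sample of iteration `l` is independent of the current set, so `hgain` for fixed sets
  -- applies with the current set frozen.
  have hrec : ∀ l < k, f S - a (l + 1) ≤ (1 - c) * (f S - a l) + e := by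
    intro l hl
    obtain ⟨h1, h2, h3⟩ := integral_comp_of_indep (hH l) (hind l) (hA l)
      (hmeas l) (hbi l)
    have h4 : ∫ ω, bestValue f (A l ω) (R l (A l ω) ω) ∂μ ≤ a (l + 1) + e := by
      rw [ha, he, ← integral_add (hfi (l + 1)) hη]
      refine integral_mono_ae h1 ((hfi (l + 1)).add hη) ?_
      filter_upwards [hstep] with ω hω
      exact hω l hl
    have h5 : (1 - c) * a l + c * f S ≤ ∫ ω, ∫ ω', bestValue f (A l ω) (R l (A l ω) ω') ∂μ ∂μ := by
      have h6 : (1 - c) * a l + c * f S = ∫ ω, (f (A l ω) + c * (f S - f (A l ω))) ∂μ := by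
        have h7 : (fun ω => f (A l ω) + c * (f S - f (A l ω))) =
          fun ω => (1 - c) * f (A l ω) + c * f S := by ext ω; ring
        rw [h7, integral_add ((hfi l).const_mul _) (integrable_const _), integral_const_mul]
        simp [ha]
      rw [h6]
      exact integral_mono ((hfi l).add (((integrable_const _).sub (hfi l)).const_mul c)) h2
        fun ω => hgain l (A l ω)
    linarith
  have hall : ∀ l ≤ k, f S - a l ≤ (1 - c) ^ l * (f S - f ∅) + l * e := by
    intro l
    induction l with
    | zero => intro _; simp [ha, hA0]
    | succ l ih =>
      intro hl
      have h1 := mul_le_mul_of_nonneg_left (ih (by omega)) hc0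
      have h2 := hrec l (by omega)
      -- Earlier errors are not amplified, since `1 - c ≤ 1`; they only add up.
      have h3 : (1 - c) * (l * e) ≤ l * e := by
        have : 0 ≤ (l : ℝ) * e := by positivity
        have hc' : 0 ≤ c := div_nonneg (by linarith) hk'.le
        nlinarith
      push_cast
      rw [pow_succ]
      linarith
  have hfin := hall k le_rfl
  have hpow : (1 - c) ^ k ≤ 1 / Real.exp 1 + ε := by
    refine le_trans ?_ (exp_neg_one_sub_le hε.le hε1.le)
    calc (1 - c) ^ k ≤ Real.exp (-c) ^ k := pow_le_pow_left₀ hc0 (Real.one_sub_le_exp_neg c) k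
      _ = Real.exp (-(1 - ε)) := by
        rw [← Real.exp_nat_mul]
        congr 1
        rw [hc]; field_simp
  have hfS : f ∅ ≤ f S := hmono (Finset.empty_subset S)
  have h8 : (1 - c) ^ k * (f S - f ∅) ≤ (1 / Real.exp 1 + ε) * f S :=
    mul_le_mul hpow (by linarith) (by linarith) (by positivity)
  change _ ≤ a k
  linarith

/-- The guarantee of Stochastic-Greedy with an exact value oracle. -/
theorem integral_stochasticGreedy_ge [Fintype V] [DecidableEq V] {f : Finset V → ℝ}
    (hmono : Monotone f) (hsub : IsSubmodularFn f) (hf : 0 ≤ f ∅) {k : ℕ} (hk : 1 ≤ k) {ε : ℝ}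
    (hε : 0 < ε) (hε1 : ε < 1) {R : ℕ → Finset V → Ω' → Finset V}
    (hR : IsGreedySampling μ (sampleSize (Fintype.card V) k ε) R) (hind : iIndep (greedySigma R) μ)
    (S : Finset V) (hS : S.card ≤ k) :
    (1 - 1 / Real.exp 1 - ε) * f S ≤
      ∫ ω, f ((stochasticGreedy k fun l A => R l A ω).run (fun _ A => f A) 0).2 ∂μ := by
  have h := integral_greedy_ge (μ := μ) hmono hsub hf hk hε hε1 hR
    -- The set after `l` iterations is the output of the algorithm with budget `l`, hence a function
    -- of the samples of the earlier iterations.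
    (H := fun l => ⨆ l' ∈ {l' | l' < l}, greedySigma R l')
    (A := fun l ω => ((stochasticGreedy l fun l A => R l A ω).run (fun _ A => f A) 0).2)
    (η := fun _ => 0) (fun l => iSup₂_le fun l' _ => hR.greedySigma_le l') ?_ (fun ω => rfl) ?_
    (integrable_const _) (fun _ => le_rfl) ?_ S hS
  · simpa using h
  · intro l
    have := indep_iSup_of_disjoint (fun l => hR.greedySigma_le l) hind
      (S := {l' | l' < l}) (T := {l}) (by simp)
    simpa using this
  · intro l B
    refine @measurableSet_run_stochasticGreedy V _ Ω'
      (⨆ l' ∈ {l' | l' < l}, greedySigma R l') _ (fun _ A _ => f A)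
      (fun _ _ => @measurable_const _ _ _ _ _) R l ?_ {p | p.2 = B}
    intro l' hl' A C
    have hle : greedySigma R l' ≤ ⨆ l' ∈ {l' | l' < l}, greedySigma R l' :=
      le_iSup₂_of_le l' hl' le_rfl
    exact hle _ (measurableSet_greedySigma R l' A {C})
  · refine ae_of_all _ fun ω l hl => ?_
    simp only [run_stochasticGreedy_snd, add_zero]
    refine bestValue_le (hmono (greedyState_subset_succ _ _ l)) fun b hb => ?_
    have := greedyState_succ_ge (fun _ A => f A) (fun l A => R l A ω) f 0 k (by simp) l hl b hb
    simpa using this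

end Probability

/-- Hoeffding's inequality for the mean of random variables with values in `[0, 1]`. -/
theorem measureReal_lt_abs_mean_sub_le {Ω' ι : Type*} [MeasurableSpace Ω'] {μ : Measure Ω'}
    [IsProbabilityMeasure μ] {Y : ι → Ω' → ℝ} (hind : iIndepFun Y μ) (hm : ∀ p, Measurable (Y p))
    {s : Finset ι} {M : ℕ} (hs : s.card = M) (hM : 1 ≤ M)
    (hY : ∀ p ∈ s, ∀ᵐ ω ∂μ, Y p ω ∈ Set.Icc (0 : ℝ) 1) {c : ℝ}
    (hc : ∀ p ∈ s, ∫ ω, Y p ω ∂μ = c) {δ : ℝ} (hδ : 0 ≤ δ) :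
    μ.real {ω | δ < |(∑ p ∈ s, Y p ω) / M - c|} ≤ 2 * Real.exp (-(2 * M * δ ^ 2)) := by
  have hM' : (0 : ℝ) < M := by exact_mod_cast hM
  have hind' : iIndepFun (fun p ω => Y p ω - c) μ :=
    hind.comp (fun _ x => x - c) fun _ => measurable_id.sub_const c
  have hind'' : iIndepFun (fun p ω => -(Y p ω - c)) μ :=
    hind.comp (fun _ x => -(x - c)) fun _ => (measurable_id.sub_const c).neg
  have hsub : ∀ p ∈ s, HasSubgaussianMGF (fun ω => Y p ω - c) ((‖(1 : ℝ) - 0‖₊ / 2) ^ 2) μ := by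
    intro p hp
    have := hasSubgaussianMGF_of_mem_Icc (hm p).aemeasurable (hY p hp)
    rwa [hc p hp] at this
  have hε : 0 ≤ (M : ℝ) * δ := by positivity
  have h1 := HasSubgaussianMGF.measure_sum_ge_le_of_iIndepFun hind' hsub hε
  have h2 := HasSubgaussianMGF.measure_sum_ge_le_of_iIndepFun hind''
    (fun p hp => (hsub p hp).neg) hε
  -- Each variable has sub-Gaussian parameter `1/4`, so the exponent is `(M δ)^2 / (2 * M/4) = 2 M
  -- δ^2`.
  have hexp : -((M : ℝ) * δ) ^ 2 / (2 * ((∑ i ∈ s, (‖(1 : ℝ) - 0‖₊ / 2) ^ 2 : NNReal) : ℝ)) =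
      -(2 * M * δ ^ 2) := by
    simp only [Finset.sum_const, hs]
    push_cast
    simp only [sub_zero, norm_one, nsmul_eq_mul]
    field_simp
  rw [hexp] at h1 h2
  have hle : μ.real {ω | δ < |(∑ p ∈ s, Y p ω) / M - c|} ≤
      μ.real ({ω | M * δ ≤ ∑ p ∈ s, (Y p ω - c)} ∪ {ω | M * δ ≤ ∑ p ∈ s, -(Y p ω - c)}) := by
    refine measureReal_mono fun ω hω => ?_
    have hω : δ < |(∑ p ∈ s, Y p ω) / M - c| := hω
    have h3 : ∑ p ∈ s, (Y p ω - c) = M * ((∑ p ∈ s, Y p ω) / M - c) := by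
      rw [Finset.sum_sub_distrib, Finset.sum_const, hs, nsmul_eq_mul]
      field_simp
    rcases lt_abs.mp hω with h | h
    · left
      change M * δ ≤ _
      rw [h3]
      exact mul_le_mul_of_nonneg_left h.le hM'.le
    · right
      change M * δ ≤ _
      rw [Finset.sum_neg_distrib, h3, ← mul_neg]
      exact mul_le_mul_of_nonneg_left h.le hM'.le
  calc _ ≤ _ := hle
    _ ≤ _ := measureReal_union_le _ _
    _ ≤ _ := add_le_add h1 h2
    _ = _ := by ring

/-! ### Adaptivity of the actions and concentration of the feedback -/

section Bandit

variable {Ω' : Type*} {V Agent : Type} [Fintype V] [DecidableEq V] [Fintype Agent]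

/-- The σ-algebras of the independent sources of randomness of C-MA-MAB. -/
@[reducible] def banditSigma (X : Agent → ℕ → Finset V → Ω' → ℝ) (Q : ℕ → Ω' → Finset Agent)
    (R : ℕ → Finset V → Ω' → Finset V) (c : (Agent × ℕ) ⊕ ℕ ⊕ ℕ) : MeasurableSpace Ω' :=
  match c with
  | .inl p => MeasurableSpace.comap (fun ω A => X p.1 p.2 A ω) MeasurableSpace.pi
  | .inr (.inl j) => MeasurableSpace.comap (Q j) ⊤
  | .inr (.inr l) => greedySigma R l

/-- The σ-algebra of all random choices and of the rewards before time `τ`. -/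
@[reducible] def pastSigma (X : Agent → ℕ → Finset V → Ω' → ℝ) (Q : ℕ → Ω' → Finset Agent)
    (R : ℕ → Finset V → Ω' → Finset V) (τ : ℕ) : MeasurableSpace Ω' :=
  ⨆ c ∈ {c : (Agent × ℕ) ⊕ ℕ ⊕ ℕ | ∀ p, c = .inl p → p.2 < τ}, banditSigma X Q R c

/-- The σ-algebra of the rewards from time `τ` on. -/
@[reducible] def futureSigma (X : Agent → ℕ → Finset V → Ω' → ℝ) (Q : ℕ → Ω' → Finset Agent)
    (R : ℕ → Finset V → Ω' → Finset V) (τ : ℕ) : MeasurableSpace Ω' :=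
  ⨆ c ∈ {c : (Agent × ℕ) ⊕ ℕ ⊕ ℕ | ∃ p, c = .inl p ∧ τ ≤ p.2}, banditSigma X Q R c

/-- The σ-algebra of all randomness except the samples of the iterations from `l` on. -/
@[reducible] def iterationSigma (X : Agent → ℕ → Finset V → Ω' → ℝ) (Q : ℕ → Ω' → Finset Agent)
    (R : ℕ → Finset V → Ω' → Finset V) (l : ℕ) : MeasurableSpace Ω' :=
  ⨆ c ∈ {c : (Agent × ℕ) ⊕ ℕ ⊕ ℕ | ∀ l', c = .inr (.inr l') → l' < l}, banditSigma X Q R c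

/-- The exploration phase of C-MA-MAB with Stochastic-Greedy, with `r` plays of every queried
action. -/
noncomputable def greedyBanditRun (k m r : ℕ) (X : Agent → ℕ → Finset V → Ω' → ℝ)
    (Q : ℕ → Ω' → Finset Agent) (R : ℕ → Finset V → Ω' → Finset V) (ω : Ω') :
    List (Finset V) × Finset V :=
  cmamabRun m r (fun i t A => X i t A ω) (fun j => Q j ω) (stochasticGreedy k fun l A => R l A ω)

/-- The action of round `j`. -/
noncomputable def roundAction (k m r : ℕ) (X : Agent → ℕ → Finset V → Ω' → ℝ)
    (Q : ℕ → Ω' → Finset Agent) (R : ℕ → Finset V → Ω' → Finset V) (j : ℕ) (ω : Ω') : Finset V :=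
  (greedyBanditRun k m r X Q R ω).1.getD j (greedyBanditRun k m r X Q R ω).2

variable {X : Agent → ℕ → Finset V → Ω' → ℝ} {Q : ℕ → Ω' → Finset Agent}
  {R : ℕ → Finset V → Ω' → Finset V}

omit [Fintype V] [DecidableEq V] [Fintype Agent] in
theorem measurable_reward_banditSigma (i : Agent) (t : ℕ) (A : Finset V) :
    Measurable[banditSigma X Q R (.inl (i, t))] (X i t A) := by
  have h : Measurable[banditSigma X Q R (.inl (i, t))] (fun ω A => X i t A ω) :=
    @comap_measurable Ω' _ _ (fun ω A => X i t A ω)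
  exact (measurable_pi_apply A).comp h

omit [Fintype V] [DecidableEq V] [Fintype Agent] in
theorem measurableSet_agents_banditSigma (j : ℕ) (S : Set (Finset Agent)) :
    MeasurableSet[banditSigma X Q R (.inr (.inl j))] {ω | Q j ω ∈ S} :=
  ⟨S, trivial, rfl⟩

omit [Fintype V] [DecidableEq V] in
theorem measurable_cmamabFeedback [DecidableEq Agent] {𝓕 : MeasurableSpace Ω'} (m r j : ℕ)
    (A : Finset V)
    (hX : ∀ i, ∀ u < r, Measurable[𝓕] (X i (j * r + u) A))
    (hQ : ∀ S, MeasurableSet[𝓕] {ω | Q j ω ∈ (S : Set (Finset Agent))}) :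
    Measurable[𝓕] fun ω => cmamabFeedback m r (fun i t A => X i t A ω) (fun j => Q j ω) j A := by
  have h : (fun ω => cmamabFeedback m r (fun i t A => X i t A ω) (fun j => Q j ω) j A) =
      fun ω => (∑ i, if i ∈ Q j ω then (∑ u ∈ Finset.range r, X i (j * r + u) A ω) / r else 0)
        / m := by
    ext ω
    rw [cmamabFeedback, Finset.sum_ite_mem, Finset.univ_inter]
  rw [h]
  refine Measurable.div_const (Finset.measurable_sum _ fun i _ => Measurable.ite (hQ {q | i ∈ q})
    (Measurable.div_const (Finset.measurable_sum _ fun u hu => ?_) _) measurable_const) _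
  exact hX i u (Finset.mem_range.mp hu)

omit [Fintype V] [Fintype Agent] in
theorem card_roundAction_le (k m r j : ℕ) (ω : Ω') : (roundAction k m r X Q R j ω).card ≤ k :=
  card_getD_run_stochasticGreedy_le _ _ k j

/-- Round `j` starts at time `j * r`, and its action uses only the feedback of earlier rounds. This
is what makes it independent of the rewards it collects. -/
theorem measurableSet_roundAction (k m r j : ℕ) (B : Finset V) :
    MeasurableSet[pastSigma X Q R (j * r)] {ω | roundAction k m r X Q R j ω = B} := by
  classical
  set 𝓕 := pastSigma X Q R (j * r) with h𝓕
  -- Cutting the oracle off from round `j` on leaves the action unchanged and makes every answer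
  -- measurable with respect to the past.
  set o : ℕ → Finset V → Ω' → ℝ := fun i A ω =>
    if i < j then cmamabFeedback m r (fun i t A => X i t A ω) (fun j => Q j ω) i A else 0 with ho
  have hle : ∀ c : (Agent × ℕ) ⊕ ℕ ⊕ ℕ, (∀ p, c = .inl p → p.2 < j * r) →
      banditSigma X Q R c ≤ 𝓕 := fun c hc => le_iSup₂_of_le c hc le_rfl
  have hom : ∀ i A, Measurable[𝓕] (o i A) := by
    intro i A
    by_cases hij : i < j
    · simp only [ho, hij, if_true]
      refine measurable_cmamabFeedback m r i A (fun a u hu => ?_) fun S => ?_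
      · refine (measurable_reward_banditSigma (X := X) (Q := Q) (R := R) a (i * r + u) A).mono
          (hle _ ?_) le_rfl
        rintro p hp
        obtain rfl := Sum.inl_injective hp
        have : (i + 1) * r ≤ j * r := Nat.mul_le_mul_right r hij
        simp only
        linarith
      · exact hle (.inr (.inl i)) (fun p hp => by simp at hp) _
          (measurableSet_agents_banditSigma i S)
    · simp only [ho, hij, if_false]
      exact @measurable_const _ _ _ 𝓕 _
  have hrun := @measurableSet_run_stochasticGreedy V _ Ω' 𝓕 _ o hom R k
    (fun l _ A C => hle (.inr (.inr l)) (fun p hp => by simp at hp) _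
      (measurableSet_greedySigma R l A {C})) {p | p.1.getD j p.2 = B}
  convert hrun using 1
  ext ω
  change (roundAction k m r X Q R j ω = B) ↔ _ = B
  rw [← getD_run_congr (fun i A => cmamabFeedback m r (fun i t A => X i t A ω)
    (fun j => Q j ω) i A) (fun i A => o i A ω) _ 0 j]
  · rfl
  · intro i hi
    ext A
    simp only [ho]
    rw [if_pos (by omega)]

variable [m0 : MeasurableSpace Ω'] {μ : Measure Ω'} [IsProbabilityMeasure μ]
  {k m s : ℕ} {f : Finset V → ℝ}

omit [IsProbabilityMeasure μ] in
theorem IsGreedyBanditEnv.banditSigma_le (h : IsGreedyBanditEnv μ k m s f X Q R)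
    (c : (Agent × ℕ) ⊕ ℕ ⊕ ℕ) : banditSigma X Q R c ≤ m0 := by
  rcases c with p | j | l
  · exact (measurable_pi_iff.mpr fun A => h.measurable_reward p.1 p.2 A).comap_le
  · rintro _ ⟨S, -, rfl⟩
    rw [← Set.biUnion_preimage_singleton]
    exact MeasurableSet.biUnion (Set.to_countable S) fun q _ => (h.agents_uniform j).1 q
  · exact h.sampling.greedySigma_le l

omit [IsProbabilityMeasure μ] in
theorem IsGreedyBanditEnv.iIndep_banditSigma (h : IsGreedyBanditEnv μ k m s f X Q R) :
    iIndep (banditSigma X Q R) μ := h.indep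

omit [IsProbabilityMeasure μ] in
theorem IsGreedyBanditEnv.pastSigma_le (h : IsGreedyBanditEnv μ k m s f X Q R) (τ : ℕ) :
    pastSigma X Q R τ ≤ m0 := iSup₂_le fun c _ => h.banditSigma_le c

omit [IsProbabilityMeasure μ] in
theorem IsGreedyBanditEnv.indep_past_future (h : IsGreedyBanditEnv μ k m s f X Q R) (τ : ℕ) :
    Indep (pastSigma X Q R τ) (futureSigma X Q R τ) μ := by
  refine indep_iSup_of_disjoint h.banditSigma_le h.iIndep_banditSigma ?_
  rw [Set.disjoint_left]
  rintro c hc ⟨p, rfl, hp⟩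
  exact absurd (hc p rfl) (not_lt.mpr hp)

omit [IsProbabilityMeasure μ] in
theorem IsGreedyBanditEnv.indep_iterationSigma (h : IsGreedyBanditEnv μ k m s f X Q R) (l : ℕ) :
    Indep (iterationSigma X Q R l) (greedySigma R l) μ := by
  have := indep_iSup_of_disjoint h.banditSigma_le h.iIndep_banditSigma
    (S := {c | ∀ l', c = .inr (.inr l') → l' < l}) (T := {.inr (.inr l)}) (by simp)
  rw [_root_.iSup_singleton] at this
  exact this

omit [Fintype V] [DecidableEq V] [Fintype Agent] m0 in
theorem measurable_reward_futureSigma {τ t : ℕ} (ht : τ ≤ t) (i : Agent) (A : Finset V) :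
    Measurable[futureSigma X Q R τ] (X i t A) :=
  (measurable_reward_banditSigma (X := X) (Q := Q) (R := R) i t A).mono
    (le_iSup₂_of_le (.inl (i, t)) ⟨(i, t), rfl, ht⟩ le_rfl) le_rfl

theorem IsGreedyBanditEnv.integrable_reward (h : IsGreedyBanditEnv μ k m s f X Q R) (i : Agent)
    (t : ℕ) {A : Finset V} (hA : A.card ≤ k) : Integrable (X i t A) μ :=
  Integrable.of_mem_Icc 0 1 (h.measurable_reward i t A).aemeasurable (h.reward_mem i t A hA)

theorem IsGreedyBanditEnv.mean_mem (h : IsGreedyBanditEnv μ k m s f X Q R) (i : Agent)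
    {A : Finset V} (hA : A.card ≤ k) : f A ∈ Set.Icc (0 : ℝ) 1 := by
  rw [← h.reward_mean i 0 A hA]
  refine ⟨integral_nonneg_of_ae ?_, ?_⟩
  · filter_upwards [h.reward_mem i 0 A hA] with ω hω using hω.1
  · have : ∫ ω, X i 0 A ω ∂μ ≤ ∫ _, (1 : ℝ) ∂μ := by
      refine integral_mono_ae (h.integrable_reward i 0 hA) (integrable_const _) ?_
      filter_upwards [h.reward_mem i 0 A hA] with ω hω using hω.2
    simpa using this

/-- The expected reward of an adaptively chosen action is the expectation of its mean. -/
theorem IsGreedyBanditEnv.integral_reward_roundAction (h : IsGreedyBanditEnv μ k m s f X Q R)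
    (r : ℕ) (i : Agent) (t : ℕ) :
    Integrable (fun ω => X i t (roundAction k m r X Q R (t / r) ω) ω) μ ∧
      Integrable (fun ω => f (roundAction k m r X Q R (t / r) ω)) μ ∧
      ∫ ω, X i t (roundAction k m r X Q R (t / r) ω) ω ∂μ =
        ∫ ω, f (roundAction k m r X Q R (t / r) ω) ∂μ := by
  -- The cutoff is needed because integrability is known only for sets of size at most `k`; the
  -- actions never leave that range.
  set Z : Finset V → Ω' → ℝ := fun A => if A.card ≤ k then X i t A else fun _ => 0 with hZ
  have hmain := integral_comp_of_indep (Z := Z) (h.pastSigma_le (t / r * r))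
    (h.indep_past_future (t / r * r)) (measurableSet_roundAction k m r (t / r)) ?_ ?_
  · have h1 : ∀ ω, Z (roundAction k m r X Q R (t / r) ω) =
        X i t (roundAction k m r X Q R (t / r) ω) := fun ω => if_pos (card_roundAction_le k m r _ ω)
    have h2 : ∀ ω, ∫ ω', X i t (roundAction k m r X Q R (t / r) ω) ω' ∂μ =
        f (roundAction k m r X Q R (t / r) ω) :=
      fun ω => h.reward_mean i t _ (card_roundAction_le k m r _ ω)
    simpa only [h1, h2] using hmain
  · intro A
    by_cases hA : A.card ≤ k
    · simp only [hZ, hA, if_true]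
      exact measurable_reward_futureSigma (Nat.div_mul_le_self t r) i A
    · simp only [hZ, hA, if_false]
      exact @measurable_const _ _ _ (futureSigma X Q R _) _
  · intro A
    by_cases hA : A.card ≤ k
    · simp only [hZ, hA, if_true]
      exact h.integrable_reward i t hA
    · simp only [hZ, hA, if_false]
      exact integrable_const _

/-- For fixed agents and action, the nested means form one mean over the rectangle of `m * r`
independent rewards. -/
theorem IsGreedyBanditEnv.measureReal_feedback_fixed_le
    (h : IsGreedyBanditEnv μ k m s f X Q R) (hm : 1 ≤ m) {r : ℕ} (hr : 1 ≤ r) (j : ℕ)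
    {q : Finset Agent} (hq : q.card = m) {A : Finset V} (hA : A.card ≤ k) {δ : ℝ} (hδ : 0 ≤ δ) :
    μ.real {ω | δ < |(∑ i ∈ q, (∑ u ∈ Finset.range r, X i (j * r + u) A ω) / r) / m - f A|} ≤
      2 * Real.exp (-(2 * (m * r : ℕ) * δ ^ 2)) := by
  have hind : iIndepFun (fun (p : Agent × ℕ) ω => X p.1 p.2 A ω) μ := by
    have h1 : iIndepFun (fun (p : Agent × ℕ) ω B => X p.1 p.2 B ω) μ :=
      h.iIndep_banditSigma.precomp (g := Sum.inl) Sum.inl_injective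
    exact h1.comp (fun _ φ => φ A) fun _ => measurable_pi_apply A
  have hmain := measureReal_lt_abs_mean_sub_le hind (fun p => h.measurable_reward p.1 p.2 A)
    (s := q ×ˢ Finset.Ico (j * r) (j * r + r)) (M := m * r) (by simp [hq])
    (Nat.mul_pos hm hr) (fun p _ => h.reward_mem p.1 p.2 A hA)
    (fun p _ => h.reward_mean p.1 p.2 A hA) hδ
  convert hmain using 6 with ω
  rw [Finset.sum_product, ← Finset.sum_div, div_div, Nat.cast_mul, mul_comm (r : ℝ)]
  congr 2
  refine Finset.sum_congr rfl fun i _ => ?_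
  rw [Finset.sum_Ico_eq_sum_range, Nat.add_sub_cancel_left]

/-- The probability that the answer in round `j` deviates from the mean by more than `δ`. -/
theorem IsGreedyBanditEnv.measureReal_feedback_le
    (h : IsGreedyBanditEnv μ k m s f X Q R) (hm : 1 ≤ m) {r : ℕ} (hr : 1 ≤ r) (j : ℕ)
    {δ : ℝ} (hδ : 0 ≤ δ) :
    MeasurableSet {ω | δ < |cmamabFeedback m r (fun i t A => X i t A ω) (fun j => Q j ω) j
      (roundAction k m r X Q R j ω) - f (roundAction k m r X Q R j ω)|} ∧
    μ.real {ω | δ < |cmamabFeedback m r (fun i t A => X i t A ω) (fun j => Q j ω) j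
      (roundAction k m r X Q R j ω) - f (roundAction k m r X Q R j ω)|} ≤
      2 * Real.exp (-(2 * (m * r : ℕ) * δ ^ 2)) := by
  classical
  set bad := {ω | δ < |cmamabFeedback m r (fun i t A => X i t A ω) (fun j => Q j ω) j
      (roundAction k m r X Q R j ω) - f (roundAction k m r X Q R j ω)|} with hbad
  set D : Finset V × Finset Agent → Set Ω' := fun c =>
    {ω | δ < |(∑ i ∈ c.2, (∑ u ∈ Finset.range r, X i (j * r + u) c.1 ω) / r) / m - f c.1|} with hD
  -- Action and reporting agents are determined by the past, while the deviation events `D c` depend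
  -- on the future, so `Y` can be frozen.
  set Y : Ω' → Finset V × Finset Agent := fun ω => (roundAction k m r X Q R j ω, Q j ω) with hYdef
  have hY : ∀ c, MeasurableSet[pastSigma X Q R (j * r)] {ω | Y ω = c} := by
    rintro ⟨A, q⟩
    have h1 := measurableSet_roundAction (X := X) (Q := Q) (R := R) k m r j A
    have hle : banditSigma X Q R (.inr (.inl j)) ≤ pastSigma X Q R (j * r) :=
      le_iSup₂_of_le (.inr (.inl j)) (fun p hp => by simp at hp) le_rfl
    have h2 := hle _ (measurableSet_agents_banditSigma (X := X) (Q := Q) (R := R) j {q})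
    convert @MeasurableSet.inter _ (pastSigma X Q R (j * r)) _ _ h1 h2 using 1
    ext ω
    simp [hYdef]
  have hDm : ∀ c, MeasurableSet[futureSigma X Q R (j * r)] (D c) := by
    intro c
    have hmeas : Measurable[futureSigma X Q R (j * r)] fun ω =>
        |(∑ i ∈ c.2, (∑ u ∈ Finset.range r, X i (j * r + u) c.1 ω) / r) / m - f c.1| := by
      refine _root_.continuous_abs.measurable.comp (Measurable.sub_const (Measurable.div_const
        (Finset.measurable_sum _ fun i _ => Measurable.div_const
          (Finset.measurable_sum _ fun u _ => ?_) _) _) _)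
      exact measurable_reward_futureSigma (Nat.le_add_right _ _) i c.1
    exact hmeas measurableSet_Ioi
  have hfut : futureSigma X Q R (j * r) ≤ m0 := iSup₂_le fun c _ => h.banditSigma_le c
  have hmem : ∀ ω, ω ∈ bad ↔ ω ∈ D (Y ω) := fun ω => by
    simp only [hbad, hD, hYdef, cmamabFeedback, Set.mem_ofPred_eq]
  have hbadeq : bad = ⋃ c, ({ω | Y ω = c} ∩ D c) := by
    ext ω
    rw [hmem, Set.mem_iUnion]
    constructor
    · exact fun hω => ⟨Y ω, rfl, hω⟩
    · rintro ⟨c, hc, hω⟩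
      have hc : Y ω = c := hc
      rwa [hc]
  have hbm : MeasurableSet bad := by
    rw [hbadeq]
    exact MeasurableSet.iUnion fun c => (h.pastSigma_le _ _ (hY c)).inter (hfut _ (hDm c))
  refine ⟨hbm, ?_⟩
  obtain ⟨-, h2, h3⟩ := integral_comp_of_indep (Z := fun c => (D c).indicator fun _ => (1 : ℝ))
    (h.pastSigma_le (j * r)) (h.indep_past_future (j * r)) hY
    (fun c => Measurable.indicator (@measurable_const _ _ _ (futureSigma X Q R _) _) (hDm c))
    (fun c => (integrable_const _).indicator (hfut _ (hDm c)))
  have h4 : μ.real bad = ∫ ω, (D (Y ω)).indicator (fun _ => (1 : ℝ)) ω ∂μ := by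
    rw [← integral_indicator_one hbm]
    refine integral_congr_ae (ae_of_all _ fun ω => ?_)
    by_cases hω : ω ∈ bad
    · have hω' : ω ∈ D (Y ω) := (hmem ω).mp hω
      simp only [Set.indicator_of_mem hω, Set.indicator_of_mem hω', Pi.one_apply]
    · have hω' : ω ∉ D (Y ω) := mt (hmem ω).mpr hω
      simp only [Set.indicator_of_notMem hω, Set.indicator_of_notMem hω']
  rw [h4, h3]
  have h5 : ∀ᵐ ω ∂μ, ∫ ω', (D (Y ω)).indicator (fun _ => (1 : ℝ)) ω' ∂μ ≤
      2 * Real.exp (-(2 * (m * r : ℕ) * δ ^ 2)) := by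
    filter_upwards [(h.agents_uniform j).ae_mem] with ω hω
    rw [integral_indicator_const _ (hfut _ (hDm _)), smul_eq_mul, mul_one]
    exact h.measureReal_feedback_fixed_le hm hr j (Finset.mem_powersetCard.mp hω).2
      (card_roundAction_le k m r j ω) hδ
  calc _ ≤ ∫ _, 2 * Real.exp (-(2 * (m * r : ℕ) * δ ^ 2)) ∂μ :=
        integral_mono_ae h2 (integrable_const _) h5
    _ = _ := by simp

end Bandit

/-! ### From answer accuracy to regret -/

section BanditRegret

variable {Ω' : Type*} {V Agent : Type} [Fintype V] [DecidableEq V] [Fintype Agent]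
  {X : Agent → ℕ → Finset V → Ω' → ℝ} {Q : ℕ → Ω' → Finset Agent}
  {R : ℕ → Finset V → Ω' → Finset V} [m0 : MeasurableSpace Ω'] {μ : Measure Ω'}
  [IsProbabilityMeasure μ] {k m s : ℕ} {f : Finset V → ℝ}

theorem IsGreedyBanditEnv.ae_card_sample_le (h : IsGreedyBanditEnv μ k m s f X Q R) :
    ∀ᵐ ω ∂μ, ∀ l A, (R l A ω).card ≤ s := by
  rw [ae_all_iff]
  intro l
  rw [ae_all_iff]
  intro A
  filter_upwards [(h.sampling l A).ae_mem] with ω hω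
  rw [(Finset.mem_powersetCard.mp hω).2]
  exact min_le_left _ _

theorem IsGreedyBanditEnv.ae_length_le (h : IsGreedyBanditEnv μ k m s f X Q R) (r : ℕ) :
    ∀ᵐ ω ∂μ, (greedyBanditRun k m r X Q R ω).1.length ≤ k * s := by
  filter_upwards [h.ae_card_sample_le] with ω hω
  rw [greedyBanditRun, cmamabRun, length_run_stochasticGreedy]
  exact greedyState_snd_le _ _ s hω k

omit [Fintype V] [Fintype Agent] m0 in
theorem card_greedyBanditRun_snd_le (k m r : ℕ) (ω : Ω') :
    (greedyBanditRun k m r X Q R ω).2.card ≤ k :=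
  (card_stochasticGreedyFrom_le _ _ k k 0 ∅ 0 (by simp)).2

omit m0 in
-- Here the rewards of all times may enter, since the greedy recursion only needs independence from
-- the sample of iteration `l`.
theorem measurableSet_greedyBanditRun_snd (m r l : ℕ) (B : Finset V) :
    MeasurableSet[iterationSigma X Q R l] {ω | (greedyBanditRun l m r X Q R ω).2 = B} := by
  classical
  set 𝓕 := iterationSigma X Q R l
  have hle : ∀ c : (Agent × ℕ) ⊕ ℕ ⊕ ℕ, (∀ l', c = .inr (.inr l') → l' < l) →
      banditSigma X Q R c ≤ 𝓕 := fun c hc => le_iSup₂_of_le c hc le_rfl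
  have ho : ∀ i A, Measurable[𝓕] fun ω =>
      cmamabFeedback m r (fun i t A => X i t A ω) (fun j => Q j ω) i A := by
    intro i A
    refine measurable_cmamabFeedback m r i A (fun a u hu => ?_) fun S => ?_
    · exact (measurable_reward_banditSigma (X := X) (Q := Q) (R := R) a (i * r + u) A).mono
        (hle _ fun l' hl' => by simp at hl') le_rfl
    · exact hle (.inr (.inl i)) (fun p hp => by simp at hp) _
        (measurableSet_agents_banditSigma i S)
  refine @measurableSet_run_stochasticGreedy V _ Ω' 𝓕 _ (fun i A ω =>
      cmamabFeedback m r (fun i t A => X i t A ω) (fun j => Q j ω) i A) ho R l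
    (fun l' hl' A C => hle (.inr (.inr l')) (fun p hp => ?_) _
      (measurableSet_greedySigma R l' A {C})) {p | p.2 = B}
  obtain rfl := Sum.inr_injective (Sum.inr_injective hp)
  exact hl'

/-- The quality of the output of Stochastic-Greedy if its queries are answered by C-MA-MAB. -/
theorem IsGreedyBanditEnv.integral_output_ge [Nonempty Agent] {ε : ℝ}
    (h : IsGreedyBanditEnv μ k m (sampleSize (Fintype.card V) k ε) f X Q R) (hmono : Monotone f)
    (hsub : IsSubmodularFn f) (hk : 1 ≤ k) (hε : 0 < ε) (hε1 : ε < 1) (hm : 1 ≤ m) {r : ℕ}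
    (hr : 1 ≤ r) {δ : ℝ} (hδ : 0 ≤ δ) (S : Finset V) (hS : S.card ≤ k) :
    (1 - 1 / Real.exp 1 - ε) * f S - k * (2 * δ + (k * sampleSize (Fintype.card V) k ε : ℕ) *
      (2 * Real.exp (-(2 * (m * r : ℕ) * δ ^ 2)))) ≤
      ∫ ω, f (greedyBanditRun k m r X Q R ω).2 ∂μ := by
  obtain ⟨i₀⟩ := ‹Nonempty Agent›
  set N := k * sampleSize (Fintype.card V) k ε with hN
  set bad : ℕ → Set Ω' := fun j =>
    {ω | δ < |cmamabFeedback m r (fun i t A => X i t A ω) (fun j => Q j ω) j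
      (roundAction k m r X Q R j ω) - f (roundAction k m r X Q R j ω)|} with hbad
  -- The union runs over the deterministic number `N` of rounds, which almost surely bounds the
  -- random number of queries.
  set B : Set Ω' := ⋃ j ∈ Finset.range N, bad j with hB
  have hBm : MeasurableSet B :=
    Finset.measurableSet_biUnion _ fun j _ => (h.measureReal_feedback_le hm hr j hδ).1
  have hBle : μ.real B ≤ N * (2 * Real.exp (-(2 * (m * r : ℕ) * δ ^ 2))) := by
    refine (measureReal_biUnion_finset_le _ _).trans ?_
    have := Finset.sum_le_card_nsmul (Finset.range N) (fun j => μ.real (bad j)) _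
      fun j _ => (h.measureReal_feedback_le hm hr j hδ).2
    simpa using this
  -- Outside `B` an iteration loses at most `2δ`; on `B` it loses at most `1`, because the means lie
  -- in `[0, 1]`.
  set η : Ω' → ℝ := fun ω => 2 * δ + B.indicator (fun _ => (1 : ℝ)) ω with hη
  have hηi : Integrable η μ := (integrable_const _).add ((integrable_const _).indicator hBm)
  have hηint : ∫ ω, η ω ∂μ = 2 * δ + μ.real B := by
    rw [hη, integral_add (integrable_const _) ((integrable_const _).indicator hBm),
      integral_indicator_const _ hBm]
    simp
  have hI0 : ∀ ω, 0 ≤ B.indicator (fun _ => (1 : ℝ)) ω :=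
    fun ω => Set.indicator_nonneg (fun _ _ => zero_le_one) ω
  have hf0 : ∀ A : Finset V, A.card ≤ k → 0 ≤ f A := fun A hA => (h.mean_mem i₀ hA).1
  have hf1 : ∀ A : Finset V, A.card ≤ k → f A ≤ 1 := fun A hA => (h.mean_mem i₀ hA).2
  have hmain := integral_greedy_ge hmono hsub (hf0 ∅ (by simp)) hk hε hε1 h.sampling
    (H := fun l => iterationSigma X Q R l) (A := fun l ω => (greedyBanditRun l m r X Q R ω).2)
    (η := η) (fun l => iSup₂_le fun c _ => h.banditSigma_le c) h.indep_iterationSigma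
    (fun ω => rfl) (fun l C => measurableSet_greedyBanditRun_snd m r l C) hηi
    (fun ω => add_nonneg (by positivity) (hI0 ω)) ?_ S hS
  · refine le_trans (sub_le_sub_left (mul_le_mul_of_nonneg_left ?_ (Nat.cast_nonneg k)) _) hmain
    rw [hηint]
    linarith
  filter_upwards [h.ae_length_le r] with ω hlen l hl
  have hcard := card_greedyBanditRun_snd_le (X := X) (Q := Q) (R := R) l m r ω
  have hcard' := card_greedyBanditRun_snd_le (X := X) (Q := Q) (R := R) (l + 1) m r ω
  have hstate : ∀ l, (greedyBanditRun l m r X Q R ω).2 = (greedyState (fun j A =>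
      cmamabFeedback m r (fun i t A => X i t A ω) (fun j => Q j ω) j A)
      (fun l A => R l A ω) l).1 := fun l => run_stochasticGreedy_snd _ _ l
  refine bestValue_le ?_ fun b hb => ?_
  · have h1 : (greedyBanditRun l m r X Q R ω).2 ⊆ (greedyBanditRun (l + 1) m r X Q R ω).2 := by
      rw [hstate, hstate]
      exact greedyState_subset_succ _ _ l
    linarith [hmono h1, hI0 ω]
  · by_cases hω : ω ∈ B
    · have h1 := hf0 _ (hcard'.trans hl)
      have h2 := hf1 (insert b (greedyBanditRun l m r X Q R ω).2)
        ((Finset.card_insert_le _ _).trans (by omega))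
      simp only [hη, Set.indicator_of_mem hω]
      linarith
    · simp only [hη, Set.indicator_of_notMem hω, add_zero]
      rw [hstate] at hb
      rw [hstate, hstate]
      refine greedyState_succ_ge _ _ f δ k (fun j hj => ?_) l hl b hb
      refine not_lt.mp fun hlt => hω ?_
      exact Set.mem_biUnion (Finset.mem_range.mpr (lt_of_lt_of_le hj hlen)) hlt

theorem IsGreedyBanditEnv.integral_regret_eq (h : IsGreedyBanditEnv μ k m s f X Q R) (r : ℕ)
    (α : ℝ) (T : ℕ) (S : Finset V) (hS : S.card ≤ k) (i : Agent) :
    Integrable (fun ω => alphaRegret α T (fun i t A => X i t A ω) S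
      (cmamabAction r (greedyBanditRun k m r X Q R ω)) i) μ ∧
    ∫ ω, alphaRegret α T (fun i t A => X i t A ω) S
      (cmamabAction r (greedyBanditRun k m r X Q R ω)) i ∂μ =
      ∑ t ∈ Finset.range T, (α * f S - ∫ ω, f (roundAction k m r X Q R (t / r) ω) ∂μ) := by
  have hi : ∀ t, Integrable (fun ω => α * X i t S ω -
      X i t (roundAction k m r X Q R (t / r) ω) ω) μ := fun t =>
    ((h.integrable_reward i t hS).const_mul α).sub (h.integral_reward_roundAction r i t).1
  have heq : (fun ω => alphaRegret α T (fun i t A => X i t A ω) S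
      (cmamabAction r (greedyBanditRun k m r X Q R ω)) i) = fun ω => ∑ t ∈ Finset.range T,
      (α * X i t S ω - X i t (roundAction k m r X Q R (t / r) ω) ω) := rfl
  rw [heq]
  refine ⟨integrable_finsetSum _ fun t _ => hi t, ?_⟩
  rw [integral_finsetSum _ fun t _ => hi t]
  refine Finset.sum_congr rfl fun t _ => ?_
  rw [integral_sub ((h.integrable_reward i t hS).const_mul α)
    (h.integral_reward_roundAction r i t).1, integral_const_mul, h.reward_mean i t S hS,
    (h.integral_reward_roundAction r i t).2.2]

theorem IsGreedyBanditEnv.regret_term_le_one (h : IsGreedyBanditEnv μ k m s f X Q R) (r j : ℕ)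
    (S : Finset V) (hS : S.card ≤ k) (i : Agent) :
    (1 - 1 / Real.exp 1) * f S - ∫ ω, f (roundAction k m r X Q R j ω) ∂μ ≤ 1 := by
  have h1 : 0 ≤ ∫ ω, f (roundAction k m r X Q R j ω) ∂μ :=
    integral_nonneg fun ω => (h.mean_mem i (card_roundAction_le k m r j ω)).1
  have h2 := h.mean_mem i hS
  have h3 : 0 ≤ 1 / Real.exp 1 * f S := mul_nonneg (by positivity) h2.1
  linarith [h2.2]

/-- The regret is at most the number of exploration steps plus the loss of the exploitation
phase. -/
theorem IsGreedyBanditEnv.integral_regret_le {ε : ℝ}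
    (h : IsGreedyBanditEnv μ k m (sampleSize (Fintype.card V) k ε) f X Q R) (hmono : Monotone f)
    (hsub : IsSubmodularFn f) (hk : 1 ≤ k) (hε : 0 < ε) (hε1 : ε < 1) (hm : 1 ≤ m) {r : ℕ}
    (hr : 1 ≤ r) {δ : ℝ} (hδ : 0 ≤ δ) (T : ℕ) (S : Finset V) (hS : S.card ≤ k) (i : Agent) :
    ∫ ω, alphaRegret (1 - 1 / Real.exp 1) T (fun i t A => X i t A ω) S
      (cmamabAction r (greedyBanditRun k m r X Q R ω)) i ∂μ ≤
      (k * sampleSize (Fintype.card V) k ε : ℕ) * r +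
        T * (ε + k * (2 * δ + (k * sampleSize (Fintype.card V) k ε : ℕ) *
          (2 * Real.exp (-(2 * (m * r : ℕ) * δ ^ 2))))) := by
  have : Nonempty Agent := ⟨i⟩
  have hout := h.integral_output_ge hmono hsub hk hε hε1 hm hr hδ S hS
  rw [(h.integral_regret_eq r _ T S hS i).2]
  set N := k * sampleSize (Fintype.card V) k ε with hN
  set D := ε + k * (2 * δ + N * (2 * Real.exp (-(2 * (m * r : ℕ) * δ ^ 2)))) with hD
  have hD0 : 0 ≤ D := by positivity
  have hterm : ∀ t ∈ Finset.range T,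
      (1 - 1 / Real.exp 1) * f S - ∫ ω, f (roundAction k m r X Q R (t / r) ω) ∂μ ≤
        (if t ∈ Finset.range (N * r) then 1 else 0) + D := by
    intro t _
    split_ifs with ht
    · linarith [h.regret_term_le_one r (t / r) S hS i]
    · have htN : N ≤ t / r := by
        rw [Nat.le_div_iff_mul_le hr]
        simpa using ht
      have heq : ∫ ω, f (roundAction k m r X Q R (t / r) ω) ∂μ =
          ∫ ω, f (greedyBanditRun k m r X Q R ω).2 ∂μ := by
        refine integral_congr_ae ?_
        filter_upwards [h.ae_length_le r] with ω hω
        rw [roundAction, List.getD_eq_default _ _ (hω.trans htN)]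
      rw [heq]
      have hεS : ε * f S ≤ ε := mul_le_of_le_one_right hε.le (h.mean_mem i hS).2
      linarith
  refine (Finset.sum_le_sum hterm).trans ?_
  rw [Finset.sum_add_distrib, Finset.sum_const, Finset.card_range, nsmul_eq_mul]
  refine add_le_add ?_ le_rfl
  calc ∑ t ∈ Finset.range T, (if t ∈ Finset.range (N * r) then (1 : ℝ) else 0)
      = ((Finset.range T ∩ Finset.range (N * r)).card : ℝ) := by
        rw [Finset.sum_ite_mem, Finset.sum_const, nsmul_eq_mul, mul_one]
    _ ≤ ((Finset.range (N * r)).card : ℝ) := by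
        exact_mod_cast Finset.card_le_card Finset.inter_subset_right
    _ = N * r := by simp

end BanditRegret

/-! ### Choice of parameters and resulting rates -/

section Rates

/-- The rate of the regret bound. -/
noncomputable def regretRate (n k m T : ℕ) : ℝ :=
  (m : ℝ) ^ (-(1 / 3 : ℝ)) * (k : ℝ) ^ (2 / 3 : ℝ) * (n : ℝ) ^ (1 / 3 : ℝ) * (T : ℝ) ^ (2 / 3 : ℝ)

theorem isLittleO_rpow_mul_log_rpow (c p : ℝ) :
    (fun T : ℕ => c * (T : ℝ) ^ (2 / 3 : ℝ) * Real.log T ^ p) =o[Filter.atTop]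
      fun T : ℕ => (T : ℝ) := by
  have h1 : (fun T : ℕ => Real.log T ^ p) =o[Filter.atTop] fun T : ℕ => (T : ℝ) ^ (1 / 3 : ℝ) :=
    (isLittleO_log_rpow_rpow_atTop p (by norm_num : (0 : ℝ) < 1 / 3)).comp_tendsto
      tendsto_natCast_atTop_atTop
  have h2 : (fun T : ℕ => c * (T : ℝ) ^ (2 / 3 : ℝ)) =O[Filter.atTop]
      fun T : ℕ => (T : ℝ) ^ (2 / 3 : ℝ) := Asymptotics.isBigO_const_mul_self c _ _
  refine (h2.mul_isLittleO h1).congr_right fun T => ?_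
  rw [← Real.rpow_add_of_nonneg (Nat.cast_nonneg T) (by norm_num) (by norm_num)]
  norm_num

theorem half_le_log_natCast {T : ℕ} (hT : 2 ≤ T) : 1 / 2 ≤ Real.log T := by
  have h : Real.log 2 ≤ Real.log T :=
    Real.log_le_log (by norm_num) (by exact_mod_cast hT)
  linarith [Real.log_two_gt_d9]

variable {n k m T : ℕ}

/-- Write `n = n^(1/3) * n^(2/3)` and use `n^(2/3) * m^(2/3) ≤ T^(2/3)`. This absorbs the cost of
rounding the number of repetitions up. -/
theorem natCast_le_regretRate (hk : 1 ≤ k) (hm : 1 ≤ m) (hnm : n * m ≤ T) :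
    (n : ℝ) ≤ regretRate n k m T := by
  have hm0 : (0 : ℝ) < m := by exact_mod_cast hm
  have hm1 : (1 : ℝ) ≤ m := by exact_mod_cast hm
  have hn0 : (0 : ℝ) ≤ n := Nat.cast_nonneg n
  have h1 : (n : ℝ) ^ (2 / 3 : ℝ) * (m : ℝ) ^ (2 / 3 : ℝ) ≤ (T : ℝ) ^ (2 / 3 : ℝ) := by
    rw [← Real.mul_rpow hn0 hm0.le]
    exact Real.rpow_le_rpow (by positivity) (by exact_mod_cast hnm) (by norm_num)
  have h2 : (1 : ℝ) ≤ (k : ℝ) ^ (2 / 3 : ℝ) :=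
    Real.one_le_rpow (by exact_mod_cast hk) (by norm_num)
  have h3 : (1 : ℝ) ≤ (m : ℝ) ^ (-(1 / 3 : ℝ)) * (m : ℝ) ^ (2 / 3 : ℝ) := by
    rw [← Real.rpow_add hm0]
    exact Real.one_le_rpow hm1 (by norm_num)
  have h4 : (n : ℝ) = (n : ℝ) ^ (1 / 3 : ℝ) * (n : ℝ) ^ (2 / 3 : ℝ) := by
    rw [← Real.rpow_add_of_nonneg hn0 (by norm_num) (by norm_num)]
    norm_num
  calc (n : ℝ) = 1 * 1 * ((n : ℝ) ^ (1 / 3 : ℝ) * (n : ℝ) ^ (2 / 3 : ℝ)) := by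
        rw [← h4]; ring
    _ ≤ (m : ℝ) ^ (-(1 / 3 : ℝ)) * (m : ℝ) ^ (2 / 3 : ℝ) * (k : ℝ) ^ (2 / 3 : ℝ) *
        ((n : ℝ) ^ (1 / 3 : ℝ) * (n : ℝ) ^ (2 / 3 : ℝ)) := by
        gcongr
    _ = (m : ℝ) ^ (-(1 / 3 : ℝ)) * (k : ℝ) ^ (2 / 3 : ℝ) * (n : ℝ) ^ (1 / 3 : ℝ) *
        ((n : ℝ) ^ (2 / 3 : ℝ) * (m : ℝ) ^ (2 / 3 : ℝ)) := by ring
    _ ≤ _ := mul_le_mul_of_nonneg_left h1 (by positivity)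

/-- The real number that is rounded up to the number of repetitions. -/
noncomputable def realReps (n k m T : ℕ) : ℝ :=
  (m : ℝ)⁻¹ * (2 * k * √(Real.log T) * (T * m / n)) ^ (2 / 3 : ℝ)

theorem cmamabReps_eq : cmamabReps 0 n (2 * k) m T = ⌈realReps n k m T⌉₊ := by
  norm_num [cmamabReps, realReps]

theorem cmamabEps_eq :
    cmamabEps 0 1 n (2 * k) m T = n * cmamabReps 0 n (2 * k) m T / T := by
  norm_num [cmamabEps]

theorem mul_realReps_eq (hn : 1 ≤ n) (hm : 1 ≤ m) :
    n * realReps n k m T = (2 * √(Real.log T)) ^ (2 / 3 : ℝ) * regretRate n k m T := by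
  have hm0 : (0 : ℝ) < m := by exact_mod_cast hm
  have hn0 : (0 : ℝ) < n := by exact_mod_cast hn
  have h1 : 2 * (k : ℝ) * √(Real.log T) * (T * m / n) =
      2 * √(Real.log T) * (k * (T * (m * (n : ℝ)⁻¹))) := by
    field_simp
  have h2 : (m : ℝ)⁻¹ * (m : ℝ) ^ (2 / 3 : ℝ) = (m : ℝ) ^ (-(1 / 3 : ℝ)) := by
    rw [← Real.rpow_neg_one, ← Real.rpow_add hm0]; norm_num
  have h3 : (n : ℝ) * (n : ℝ)⁻¹ ^ (2 / 3 : ℝ) = (n : ℝ) ^ (1 / 3 : ℝ) := by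
    rw [Real.inv_rpow hn0.le, ← Real.rpow_neg hn0.le]
    nth_rewrite 1 [← Real.rpow_one (n : ℝ)]
    rw [← Real.rpow_add hn0]; norm_num
  rw [realReps, h1, Real.mul_rpow (by positivity) (by positivity),
    Real.mul_rpow (by positivity) (by positivity), Real.mul_rpow (by positivity) (by positivity),
    Real.mul_rpow (by positivity) (by positivity), Real.mul_rpow (by positivity) (by positivity),
    regretRate, ← h2, ← h3]
  ring

theorem regretRate_nonneg : 0 ≤ regretRate n k m T := by
  rw [regretRate]; positivity

theorem mul_realReps_le (hn : 1 ≤ n) (hm : 1 ≤ m) (hT : 2 ≤ T) :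
    n * realReps n k m T ≤ 3 * Real.log T * regretRate n k m T := by
  rw [mul_realReps_eq hn hm]
  refine mul_le_mul_of_nonneg_right ?_ regretRate_nonneg
  have hL := half_le_log_natCast hT
  set L := Real.log T
  have h0 : (0 : ℝ) ≤ 2 * √L := by positivity
  -- Cubing turns the claim into `4 L ≤ 27 L^3`, which follows from `L ≥ 1/2`.
  refine le_of_pow_le_pow_left₀ (n := 3) (by norm_num) (by positivity) ?_
  rw [← Real.rpow_natCast, ← Real.rpow_mul h0]
  norm_num
  rw [mul_pow, Real.sq_sqrt (by linarith)]
  nlinarith [mul_nonneg (mul_nonneg (by linarith : 0 ≤ L) (by linarith : 0 ≤ L - 1 / 2))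
    (by linarith : 0 ≤ L + 1 / 2)]

theorem realReps_pos (hn : 1 ≤ n) (hk : 1 ≤ k) (hm : 1 ≤ m) (hT : 2 ≤ T) :
    0 < realReps n k m T := by
  have hL := half_le_log_natCast hT
  have : (0 : ℝ) < n := by exact_mod_cast hn
  have : (0 : ℝ) < k := by exact_mod_cast hk
  have : (0 : ℝ) < m := by exact_mod_cast hm
  have : (0 : ℝ) < T := by exact_mod_cast (by omega : 0 < T)
  have : (0 : ℝ) < √(Real.log T) := Real.sqrt_pos.mpr (by linarith)
  rw [realReps]
  positivity

theorem one_le_cmamabReps (hn : 1 ≤ n) (hk : 1 ≤ k) (hm : 1 ≤ m) (hT : 2 ≤ T) :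
    1 ≤ cmamabReps 0 n (2 * k) m T := by
  rw [cmamabReps_eq]
  exact Nat.ceil_pos.mpr (realReps_pos hn hk hm hT)

theorem mul_cmamabReps_le (hn : 1 ≤ n) (hk : 1 ≤ k) (hm : 1 ≤ m) (hT : 2 ≤ T)
    (hnm : n * m ≤ T) :
    (n : ℝ) * cmamabReps 0 n (2 * k) m T ≤ 5 * Real.log T * regretRate n k m T := by
  have h1 : (cmamabReps 0 n (2 * k) m T : ℝ) ≤ realReps n k m T + 1 := by
    rw [cmamabReps_eq]
    exact (Nat.ceil_lt_add_one (realReps_pos hn hk hm hT).le).le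
  have h2 := mul_le_mul_of_nonneg_left h1 (Nat.cast_nonneg (α := ℝ) n)
  have h3 := mul_realReps_le (k := k) hn hm hT
  have h4 := natCast_le_regretRate hk hm hnm
  have hL := half_le_log_natCast hT
  have h5 : 0 ≤ regretRate n k m T := regretRate_nonneg
  nlinarith

/-- The balance that dictates the number of repetitions. With `Z = 2k√(log T) * Tm/n` and `z =
Z^(1/3)` one has `m r ≥ z^2`, so the estimation loss is at most `Z n/(m z) = n z^2/m`. -/
theorem mul_sqrt_log_div_le (hn : 1 ≤ n) (hk : 1 ≤ k) (hm : 1 ≤ m) (hT : 2 ≤ T) :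
    (T : ℝ) * (k * (2 * √(Real.log T / (m * cmamabReps 0 n (2 * k) m T : ℕ)))) ≤
      n * realReps n k m T := by
  have hL := half_le_log_natCast hT
  have hn0 : (0 : ℝ) < n := by exact_mod_cast hn
  have hk0 : (0 : ℝ) < k := by exact_mod_cast hk
  have hm0 : (0 : ℝ) < m := by exact_mod_cast hm
  have hT0 : (0 : ℝ) < T := by exact_mod_cast (by omega : 0 < T)
  have hsq : (0 : ℝ) < √(Real.log T) := Real.sqrt_pos.mpr (by linarith)
  set Z : ℝ := 2 * k * √(Real.log T) * (T * m / n) with hZ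
  have hZ0 : 0 < Z := by positivity
  set z : ℝ := Z ^ (1 / 3 : ℝ) with hz
  have hz0 : 0 < z := Real.rpow_pos_of_pos hZ0 _
  have hz3 : z ^ 3 = Z := by
    rw [hz, ← Real.rpow_natCast, ← Real.rpow_mul hZ0.le]; norm_num
  have hz2 : realReps n k m T = (m : ℝ)⁻¹ * z ^ 2 := by
    rw [realReps, ← hZ, hz, ← Real.rpow_natCast, ← Real.rpow_mul hZ0.le]; norm_num
  have hr : z ^ 2 ≤ (m * cmamabReps 0 n (2 * k) m T : ℕ) := by
    have h1 : realReps n k m T ≤ cmamabReps 0 n (2 * k) m T := by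
      rw [cmamabReps_eq]; exact Nat.le_ceil _
    rw [hz2, inv_mul_le_iff₀ hm0] at h1
    push_cast
    exact h1
  have hs : √(Real.log T / (m * cmamabReps 0 n (2 * k) m T : ℕ)) ≤ √(Real.log T) / z := by
    rw [← Real.sqrt_sq hz0.le, ← Real.sqrt_div (by linarith)]
    refine Real.sqrt_le_sqrt (div_le_div_of_nonneg_left (by linarith) (by positivity) hr)
  calc (T : ℝ) * (k * (2 * √(Real.log T / (m * cmamabReps 0 n (2 * k) m T : ℕ))))
      ≤ T * (k * (2 * (√(Real.log T) / z))) := by gcongr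
    _ = Z * n / m / z := by rw [hZ]; field_simp
    _ = n * realReps n k m T := by rw [← hz3, hz2]; field_simp

theorem exp_neg_two_mul_sqrt_log_div {M : ℕ} (hM : 1 ≤ M) (hT : 2 ≤ T) :
    Real.exp (-(2 * M * √(Real.log T / M) ^ 2)) = ((T : ℝ) ^ 2)⁻¹ := by
  have hM0 : (0 : ℝ) < M := by exact_mod_cast hM
  have hT0 : (0 : ℝ) < T := by exact_mod_cast (by omega : 0 < T)
  have hL := half_le_log_natCast hT
  rw [Real.sq_sqrt (by positivity), Real.exp_neg]
  congr 1
  rw [show 2 * (M : ℝ) * (Real.log T / M) = Real.log T + Real.log T by field_simp; ring,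
    Real.exp_add, Real.exp_log hT0]
  ring

/-- Since `n r ≥ 1`, the accuracy is at least `1/T`, so its logarithm costs at most `log T`. The
ceiling adds `k ≤ n ≤ 2 n log T`. -/
theorem mul_sampleSize_le (hk : 1 ≤ k) (hkn : k ≤ n) (hm : 1 ≤ m) (hT : 2 ≤ T) :
    ((k * sampleSize n k (cmamabEps 0 1 n (2 * k) m T) : ℕ) : ℝ) ≤ 3 * n * Real.log T := by
  have hL := half_le_log_natCast hT
  have hn : 1 ≤ n := hk.trans hkn
  have hn1 : (1 : ℝ) ≤ n := by exact_mod_cast hn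
  have hk0 : (0 : ℝ) < k := by exact_mod_cast hk
  have hT0 : (0 : ℝ) < T := by exact_mod_cast (by omega : 0 < T)
  have hr1 : (1 : ℝ) ≤ cmamabReps 0 n (2 * k) m T := by
    exact_mod_cast one_le_cmamabReps hn hk hm hT
  have hlog : Real.log (1 / cmamabEps 0 1 n (2 * k) m T) ≤ Real.log T := by
    rw [cmamabEps_eq, one_div_div]
    refine Real.log_le_log (by positivity) (div_le_self hT0.le ?_)
    nlinarith
  have hs : (sampleSize n k (cmamabEps 0 1 n (2 * k) m T) : ℝ) ≤ n / k * Real.log T + 1 := by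
    refine le_trans ?_ (Nat.ceil_lt_add_one (by positivity)).le
    exact_mod_cast Nat.ceil_mono (mul_le_mul_of_nonneg_left hlog (by positivity))
  push_cast
  calc (k : ℝ) * sampleSize n k (cmamabEps 0 1 n (2 * k) m T)
      ≤ k * (n / k * Real.log T + 1) := mul_le_mul_of_nonneg_left hs hk0.le
    _ = n * Real.log T + k := by field_simp
    _ ≤ _ := by
      have : (k : ℝ) ≤ n := by exact_mod_cast hkn
      nlinarith

end Rates

/-! ### Assembly of the bounds -/

theorem IsGreedyBanditEnv.integral_cmamabGreedyRegret_le {n k m m' T : ℕ} (hk : 1 ≤ k)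
    (hkn : k ≤ n) (hm : 1 ≤ m) (hT : 2 ≤ T) (hnm : n * m ≤ T) {Ω' : Type*} [MeasurableSpace Ω']
    {μ : Measure Ω'} [IsProbabilityMeasure μ] {f : Finset (Fin n) → ℝ}
    {X : Fin m' → ℕ → Finset (Fin n) → Ω' → ℝ} {Q : ℕ → Ω' → Finset (Fin m')}
    {R : ℕ → Finset (Fin n) → Ω' → Finset (Fin n)} (hmono : Monotone f) (hsub : IsSubmodularFn f)
    (h : IsGreedyBanditEnv μ k m (sampleSize n k (cmamabEps 0 1 n (2 * k) m T)) f X Q R)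
    {S : Finset (Fin n)} (hS : S.card ≤ k) (i : Fin m') :
    ∫ ω, cmamabGreedyRegret k m T X Q R S i ω ∂μ ≤ 43 * regretRate n k m T * Real.log T ^ 2 := by
  have hn : 1 ≤ n := hk.trans hkn
  have hL := half_le_log_natCast hT
  have hT0 : (0 : ℝ) < T := by exact_mod_cast (by omega : 0 < T)
  have hr := one_le_cmamabReps hn hk hm hT
  have hrB := mul_cmamabReps_le hn hk hm hT hnm
  have hε : cmamabEps 0 1 n (2 * k) m T = n * cmamabReps 0 n (2 * k) m T / T := cmamabEps_eq
  have hB : (n : ℝ) ≤ regretRate n k m T := natCast_le_regretRate hk hm hnm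
  have hB0 : 0 ≤ regretRate n k m T := regretRate_nonneg
  have hq := mul_realReps_le (k := k) hn hm hT
  have hδ := mul_sqrt_log_div_le hn hk hm hT
  have hN := mul_sampleSize_le (m := m) hk hkn hm hT
  set r := cmamabReps 0 n (2 * k) m T with hrdef
  set ε := cmamabEps 0 1 n (2 * k) m T with hεdef
  set B := regretRate n k m T with hBdef
  set L := Real.log T with hLdef
  have hLB : L * B ≤ 2 * (B * L ^ 2) := by nlinarith [mul_nonneg hB0 (by linarith : 0 ≤ L)]
  have hTε : T * ε = n * r := by rw [hε]; field_simp
  rcases lt_or_ge ε 1 with hε1 | hε1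
  · have hε0 : 0 < ε := by
      rw [hε]
      have : (0 : ℝ) < n := by exact_mod_cast hn
      have : (0 : ℝ) < r := by exact_mod_cast hr
      positivity
    have h' : IsGreedyBanditEnv μ k m (sampleSize (Fintype.card (Fin n)) k ε) f X Q R := by
      rwa [Fintype.card_fin]
    have hmain := h'.integral_regret_le hmono hsub hk hε0 hε1 hm hr
      (Real.sqrt_nonneg (L / (m * r : ℕ))) T S hS i
    rw [exp_neg_two_mul_sqrt_log_div (Nat.mul_pos hm hr) hT, Fintype.card_fin] at hmain
    set N := k * sampleSize n k ε
    refine hmain.trans ?_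
    have h1 : (N : ℝ) * r ≤ 15 * (B * L ^ 2) := by
      have h2 : (N : ℝ) * r ≤ 3 * n * L * r := mul_le_mul_of_nonneg_right hN (Nat.cast_nonneg r)
      have h3 : 3 * L * (n * r) ≤ 3 * L * (5 * L * B) :=
        mul_le_mul_of_nonneg_left hrB (by linarith)
      linarith
    have h2 : (T : ℝ) * (k * (N * (2 * ((T : ℝ) ^ 2)⁻¹))) ≤ 6 * (L * B) := by
      have h3 : (T : ℝ) * (k * (N * (2 * ((T : ℝ) ^ 2)⁻¹))) = 2 * N * (k / T) := by field_simp
      have h4 : (k : ℝ) / T ≤ 1 := by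
        rw [div_le_one hT0]
        exact_mod_cast hkn.trans ((Nat.le_mul_of_pos_right n hm).trans hnm)
      rw [h3]
      have h5 : 2 * (N : ℝ) * (k / T) ≤ 2 * N := mul_le_of_le_one_right (by positivity) h4
      have h6 : L * n ≤ L * B := mul_le_mul_of_nonneg_left hB (by linarith)
      linarith
    -- In units of `B * L ^ 2`, using `hLB`, the four terms contribute `15`, `10`, `6` and `12`,
    -- which gives `43`.
    calc _ = N * r + T * ε + T * (k * (2 * √(L / (m * r : ℕ)))) +
          T * (k * (N * (2 * ((T : ℝ) ^ 2)⁻¹))) := by ring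
      _ ≤ _ := by linarith
  · have hmain := (h.integral_regret_eq r (1 - 1 / Real.exp 1) T S hS i).2
    change ∫ ω, alphaRegret (1 - 1 / Real.exp 1) T (fun i t A => X i t A ω) S
      (cmamabAction r (greedyBanditRun k m r X Q R ω)) i ∂μ ≤ _
    rw [hmain]
    have h1 := Finset.sum_le_card_nsmul (Finset.range T) (fun t => (1 - 1 / Real.exp 1) * f S -
      ∫ ω, f (roundAction k m r X Q R (t / r) ω) ∂μ) 1
      fun t _ => h.regret_term_le_one r (t / r) S hS i
    rw [Finset.card_range, nsmul_eq_mul, mul_one] at h1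
    refine h1.trans ?_
    have h2 : (T : ℝ) ≤ T * ε := le_mul_of_one_le_right hT0.le hε1
    have h3 : 0 ≤ B * L ^ 2 := by positivity
    linarith

theorem mainTheorem5 :
    (∃ C p : ℝ, 0 < C ∧ 0 ≤ p ∧
      -- communication rounds and regret, with universal constants
      (∀ n k m m' T : ℕ, 1 ≤ k → k ≤ n → 1 ≤ m → m ≤ m' → 2 ≤ T → n * m ≤ T →
        ∀ (Ω' : Type*) [MeasurableSpace Ω'] (μ : Measure Ω') [IsProbabilityMeasure μ]
          (f : Finset (Fin n) → ℝ) (X : Fin m' → ℕ → Finset (Fin n) → Ω' → ℝ)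
          (Q : ℕ → Ω' → Finset (Fin m')) (R : ℕ → Finset (Fin n) → Ω' → Finset (Fin n)),
          Monotone f → IsSubmodularFn f →
          IsGreedyBanditEnv μ k m (sampleSize n k (cmamabEps 0 1 n (2 * k) m T)) f X Q R →
          (∀ᵐ ω ∂μ, ((cmamabGreedyRun k m T X Q R ω).1.length : ℝ) ≤
            C * n * Real.log T ^ p) ∧
          ∀ (Sstar : Finset (Fin n)) (i : Fin m'), IsOptimalSet k f Sstar →
            Integrable (cmamabGreedyRegret k m T X Q R Sstar i) μ ∧
            ∫ ω, cmamabGreedyRegret k m T X Q R Sstar i ω ∂μ ≤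
              C * ((m : ℝ) ^ (-(1 / 3 : ℝ)) * (k : ℝ) ^ (2 / 3 : ℝ) * (n : ℝ) ^ (1 / 3 : ℝ) *
                (T : ℝ) ^ (2 / 3 : ℝ)) * Real.log T ^ p) ∧
      -- for fixed `n`, `k` and `m` the regret bound is sublinear in the horizon
      (∀ n k m : ℕ,
        (fun T : ℕ => C * ((m : ℝ) ^ (-(1 / 3 : ℝ)) * (k : ℝ) ^ (2 / 3 : ℝ) *
            (n : ℝ) ^ (1 / 3 : ℝ) * (T : ℝ) ^ (2 / 3 : ℝ)) * Real.log T ^ p)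
          =o[Filter.atTop] (fun T : ℕ => (T : ℝ)))) ∧
    -- the offline guarantee of Stochastic-Greedy with an exact value oracle
    (∀ n k : ℕ, 1 ≤ k → k ≤ n → ∀ ε : ℝ, 0 < ε → ε < 1 →
      ∀ (Ω' : Type*) [MeasurableSpace Ω'] (μ : Measure Ω') [IsProbabilityMeasure μ]
        (f : Finset (Fin n) → ℝ) (R : ℕ → Finset (Fin n) → Ω' → Finset (Fin n)),
        Monotone f → IsSubmodularFn f → (∀ A, 0 ≤ f A) →
        IsGreedySampling μ (sampleSize n k ε) R → iIndep (greedySigma R) μ →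
        ∀ Sstar : Finset (Fin n), IsOptimalSet k f Sstar →
          (1 - 1 / Real.exp 1 - ε) * f Sstar ≤
            ∫ ω, f ((stochasticGreedy k fun l A => R l A ω).run (fun _ A => f A) 0).2 ∂μ) := by
  -- Both constants come from the regret; the rounds only need `3 n log T ≤ 6 n (log T)^2`.
  refine ⟨⟨43, 2, by norm_num, by norm_num, ?_, ?_⟩, ?_⟩
  · intro n k m m' T hk hkn hm _ hT hnm Ω' _ μ _ f X Q R hmono hsub h
    constructor
    · filter_upwards [h.ae_length_le (cmamabReps 0 n (2 * k) m T)] with ω hω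
      have hL := half_le_log_natCast hT
      have h1 : ((cmamabGreedyRun k m T X Q R ω).1.length : ℝ) ≤
          (k * sampleSize n k (cmamabEps 0 1 n (2 * k) m T) : ℕ) := Nat.cast_le.mpr hω
      refine h1.trans ((mul_sampleSize_le hk hkn hm hT).trans ?_)
      rw [Real.rpow_two]
      have h2 : (0 : ℝ) ≤ n * Real.log T := mul_nonneg (Nat.cast_nonneg n) (by linarith)
      nlinarith
    · intro S i hS
      refine ⟨(h.integral_regret_eq _ _ T S hS.1 i).1, ?_⟩
      rw [Real.rpow_two]
      exact h.integral_cmamabGreedyRegret_le hk hkn hm hT hnm hmono hsub hS.1 i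
  · intro n k m
    refine (isLittleO_rpow_mul_log_rpow (43 * ((m : ℝ) ^ (-(1 / 3 : ℝ)) *
      (k : ℝ) ^ (2 / 3 : ℝ) * (n : ℝ) ^ (1 / 3 : ℝ))) 2).congr_left fun T => ?_
    ring
  · intro n k hk _ ε hε hε1 Ω' _ μ _ f R hmono hsub hf hR hind S hS
    refine integral_stochasticGreedy_ge hmono hsub (hf ∅) hk hε hε1 ?_ hind S hS.1
    rwa [Fintype.card_fin]
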